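/- **Setting.** One item is sold to $n$ bidders whose values $v_i\ge 0$ are drawn independently from $\mathbf D=D_1\times\cdots\times D_n$. A (direct revelation) mechanism $M$ consists of measurable allocation probabilities $x_i(\mathbf b)\ge 0$ with $\sum_i x_i(\mathbf b)\le 1$ and measurable expected payments $p_i(\mathbf b)\in\mathbb R$. It is Bayesian incentive compatible (BIC) for $\mathbf D$ if the payments are integrable (in expectation over $\mathbf D$, and for every fixed bid of a bidder in expectation over the other bidders) and, for every bidder $i$ and every value $v_i\ge 0$, when the others bid truthfully, bidding $v_i$ maximizes the expected utility $\mathbb E[v_i x_i-p_i]$ over all bids $b\ge 0$ and makes it non-negative. Let $\mathrm{Rev}(M,\mathbf D)=\mathbb E_{\mathbf v\sim\mathbf D}\sum_i p_i(\mathbf v)$, and let $\mathrm{Opt}(\mathbf D)$ be the supremum of $\mathrm{Rev}(M,\mathbf D)$ over all mechanisms that are BIC for $\mathbf D$. A mechanism $M$ that is BIC for $\mathbf D$ is a $(1-\epsilon)$-approximation for $\mathbf D$ if $\mathrm{Rev}(M,\mathbf D)\ge(1-\epsilon)\mathrm{Opt}(\mathbf D)$, and an $\epsilon$ additive approximation if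 $\mathrm{Rev}(M,\mathbf D)\ge\mathrm{Opt}(\mathbf D)-\epsilon$. An algorithm with $m$ samples is a (possibly randomized) measurable map from $m$ value profiles to mechanisms; it may depend on $n$, $\epsilon$, $m$ and the family. It *succeeds* on a family $\mathcal F$ of distributions on $\mathbb R$ if for every $\mathbf D$ with all $D_i\in\mathcal F$, given $m$ i.i.d. samples from $\mathbf D$, it returns with probability at least $0.99$ a mechanism that is a $(1-\epsilon)$-approximation (in parts 1–3), or an $\epsilon$ additive approximation (in part 4), for $\mathbf D$. The families of *regular* and *MHR* distributions consist of: distributions with a positive density $f$ on an interval of non-negative reals, discrete distributions with mass function $f$ whose support is a set of consecutive non-negative integers, and point masses at non-negative reals; where, with the virtual value $\phi(v)=v-\frac{1-F(v)}{f(v)}$, it is required in the first two cases that on the support $\phi(v)$ is non-decreasing (regular), respectively that $\phi(v)-v$ is non-decreasing, i.e. the hazard rate $f/(1-F)$ is non-decreasing (MHR). **Theorem.** There are absolute constants $c,\epsilon_0>0$ such that the following holds. 1. For all $n\ge1$ and $0<\epsilon\le\epsilon_0$: if an algorithm with $m$ samples succeeds on the family of regular distributions, then $m\ge c\,n\,\epsilon^{-3}$.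 2. For all $n\ge2$ and $0<\epsilon\le\epsilon_0/\ln n$: if an algorithm with $m$ samples succeeds on the family of MHR distributions, then $m\ge c\,n\,\epsilon^{-2}\ln^{-2}n$. 3. For all $n\ge1$, $H\ge2$ and $0<\epsilon\le\epsilon_0$: if an algorithm with $m$ samples succeeds on the family of distributions supported in $[1,H]$, then $m\ge c\,n\,H\,\epsilon^{-2}$. 4. For all $n\ge1$ and $0<\epsilon\le\epsilon_0$: if an algorithm with $m$ samples succeeds, with $\epsilon$ additive error, on the family of distributions supported in $[0,1]$, then $m\ge c\,n\,\epsilon^{-2}$. -/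

import Mathlib

open MeasureTheory Set

/-! ### Single-item auctions with independent bidders -/

/-- A (possibly randomized) direct revelation mechanism for one item and `n` bidders:
`alloc b i` is the probability that bidder `i` gets the item when the bids are `b`, and
`pay b i` is the expected payment of bidder `i` (over the coins of the mechanism). -/
structure Mechanism (n : ℕ) where
  alloc : (Fin n → ℝ) → Fin n → ℝ
  pay : (Fin n → ℝ) → Fin n → ℝ
  alloc_nonneg : ∀ b i, 0 ≤ alloc b i
  sum_alloc_le_one : ∀ b, ∑ i, alloc b i ≤ 1
  measurable_alloc : ∀ i, Measurable fun b => alloc b i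
  measurable_pay : ∀ i, Measurable fun b => pay b i

/-- The product distribution `D₁ × ⋯ × Dₙ` of the value profile. -/
noncomputable def prior {n : ℕ} (D : Fin n → ProbabilityMeasure ℝ) : Measure (Fin n → ℝ) :=
  Measure.pi fun i => (D i : Measure ℝ)

/-- Expected revenue of `M` on `D` under truthful bidding. -/
noncomputable def Rev {n : ℕ} (M : Mechanism n) (D : Fin n → ProbabilityMeasure ℝ) : ℝ :=
  ∫ v, ∑ i, M.pay v i ∂(prior D)

/-- Expected utility of bidder `i` with value `v` who bids `b`, over the values of the other
bidders, who bid truthfully (the `i`-th coordinate of the sampled profile is overwritten). -/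
noncomputable def interimUtility {n : ℕ} (M : Mechanism n) (D : Fin n → ProbabilityMeasure ℝ)
    (i : Fin n) (v b : ℝ) : ℝ :=
  v * (∫ w, M.alloc (Function.update w i b) i ∂(prior D))
    - ∫ w, M.pay (Function.update w i b) i ∂(prior D)

/-- Bayesian incentive compatibility of `M` for the prior `D`: truthful bidding maximizes the
expected utility of every bidder at every value and guarantees that it is non-negative.
The first two fields say that the expectations involved exist. -/
structure IsBIC {n : ℕ} (M : Mechanism n) (D : Fin n → ProbabilityMeasure ℝ) : Prop where
  integrable_pay : ∀ i, Integrable (fun w => M.pay w i) (prior D)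
  integrable_interim_pay : ∀ i b, 0 ≤ b →
    Integrable (fun w => M.pay (Function.update w i b) i) (prior D)
  truthful : ∀ i v b, 0 ≤ v → 0 ≤ b → interimUtility M D i v b ≤ interimUtility M D i v v
  rational : ∀ i v, 0 ≤ v → 0 ≤ interimUtility M D i v v

/-- The optimal revenue: the supremum over all mechanisms that are BIC for `D`. -/
noncomputable def Opt {n : ℕ} (D : Fin n → ProbabilityMeasure ℝ) : EReal :=
  ⨆ (M : Mechanism n) (_ : IsBIC M D), ((Rev M D : ℝ) : EReal)

/-- `M` is a `1 - ε` (multiplicative) approximation for `D`. -/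
def IsMulApprox {n : ℕ} (ε : ℝ) (M : Mechanism n) (D : Fin n → ProbabilityMeasure ℝ) : Prop :=
  IsBIC M D ∧ ((1 - ε : ℝ) : EReal) * Opt D ≤ ((Rev M D : ℝ) : EReal)

/-- `M` is an `ε` additive approximation for `D`. -/
def IsAddApprox {n : ℕ} (ε : ℝ) (M : Mechanism n) (D : Fin n → ProbabilityMeasure ℝ) : Prop :=
  IsBIC M D ∧ Opt D ≤ ((Rev M D + ε : ℝ) : EReal)

/-! ### Learning mechanisms from samples -/

/-- A (possibly randomized) algorithm that maps `m` sampled value profiles of `n` bidders, and a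
random seed independent of the samples, to a mechanism. The outcome of the returned mechanism
depends measurably on the samples, the seed and the bids together. -/
structure LearningAlgorithm (n m : ℕ) where
  Seed : Type
  [measurableSpaceSeed : MeasurableSpace Seed]
  seedLaw : ProbabilityMeasure Seed
  output : (Fin m → Fin n → ℝ) → Seed → Mechanism n
  measurable_alloc : ∀ i, Measurable fun z : ((Fin m → Fin n → ℝ) × Seed) × (Fin n → ℝ) =>
    (output z.1.1 z.1.2).alloc z.2 i
  measurable_pay : ∀ i, Measurable fun z : ((Fin m → Fin n → ℝ) × Seed) × (Fin n → ℝ) =>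
    (output z.1.1 z.1.2).pay z.2 i

attribute [instance] LearningAlgorithm.measurableSpaceSeed

/-- The joint law of `m` i.i.d. samples from the product distribution `D` and the seed. -/
noncomputable def LearningAlgorithm.law {n m : ℕ} (A : LearningAlgorithm n m)
    (D : Fin n → ProbabilityMeasure ℝ) : Measure ((Fin m → Fin n → ℝ) × A.Seed) :=
  (Measure.pi fun _ : Fin m => prior D).prod (A.seedLaw : Measure A.Seed)

/-- On every product distribution with all marginals in the family `F`, the mechanism returned
by `A` has the property `good` with probability at least `0.99`: some event of at least that
probability is contained in the event of success. -/
def LearningAlgorithm.SucceedsOn {n m : ℕ} (A : LearningAlgorithm n m)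
    (F : Set (ProbabilityMeasure ℝ))
    (good : Mechanism n → (Fin n → ProbabilityMeasure ℝ) → Prop) : Prop :=
  ∀ D : Fin n → ProbabilityMeasure ℝ, (∀ i, D i ∈ F) →
    ∃ E : Set ((Fin m → Fin n → ℝ) × A.Seed), MeasurableSet E ∧
      ENNReal.ofReal 0.99 ≤ A.law D E ∧ ∀ z ∈ E, good (A.output z.1 z.2) D

/-! ### Families of value distributions -/

/-- The virtual value `v - (1 - F(v)) / f(v)`, where `f` is the density or the probability mass. -/
noncomputable def virtualValue (D : ProbabilityMeasure ℝ) (f : ℝ → ℝ) (v : ℝ) : ℝ :=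
  v - (D : Measure ℝ).real (Ioi v) / f v

/-- `D` lives on the interval `I` of non-negative reals and has there the positive density `f`. -/
def HasPositiveDensity (D : ProbabilityMeasure ℝ) (I : Set ℝ) (f : ℝ → ℝ) : Prop :=
  I.OrdConnected ∧ I ⊆ Ici 0 ∧ Measurable f ∧ (∀ v ∈ I, 0 < f v) ∧
    (D : Measure ℝ) = (volume.restrict I).withDensity fun v => ENNReal.ofReal (f v)

/-- The probability mass function of `D`. -/
noncomputable def mass (D : ProbabilityMeasure ℝ) (v : ℝ) : ℝ := (D : Measure ℝ).real {v}

/-- The non-negative integers that have positive mass. -/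
def natSupport (D : ProbabilityMeasure ℝ) : Set ℕ := {k | 0 < mass D k}

/-- `D` is a discrete distribution on consecutive non-negative integers. -/
def IsNatDistribution (D : ProbabilityMeasure ℝ) : Prop :=
  (D : Measure ℝ) (range ((↑) : ℕ → ℝ)) = 1 ∧ (natSupport D).OrdConnected

/-- `D` is a point mass at a non-negative real. -/
def IsPointMass (D : ProbabilityMeasure ℝ) : Prop :=
  ∃ a : ℝ, 0 ≤ a ∧ (D : Measure ℝ) = Measure.dirac a

/-- Regular distributions: the virtual value is non-decreasing. The distribution has a positive
density on an interval, or is discrete on the non-negative integers, or is a point mass. -/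
def regularDistributions : Set (ProbabilityMeasure ℝ) :=
  {D | (∃ I f, HasPositiveDensity D I f ∧ MonotoneOn (virtualValue D f) I) ∨
    (IsNatDistribution D ∧
      MonotoneOn (fun k : ℕ => virtualValue D (mass D) (k : ℝ)) (natSupport D)) ∨
    IsPointMass D}

/-- MHR distributions: the virtual value grows at rate at least `1`, that is, `φ(v) - v` is
non-decreasing; equivalently, the hazard rate `f / (1 - F)` is non-decreasing. -/
def mhrDistributions : Set (ProbabilityMeasure ℝ) :=
  {D | (∃ I f, HasPositiveDensity D I f ∧ MonotoneOn (fun v => virtualValue D f v - v) I) ∨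
    (IsNatDistribution D ∧
      MonotoneOn (fun k : ℕ => virtualValue D (mass D) (k : ℝ) - (k : ℝ)) (natSupport D)) ∨
    IsPointMass D}

/-- Distributions supported in `[a, b]`. -/
def boundedDistributions (a b : ℝ) : Set (ProbabilityMeasure ℝ) :=
  {D | (D : Measure ℝ) (Icc a b) = 1}

/-!
# Sample complexity lower bounds for single-item auctions

All four bounds come from one family of instances. A bidder has, with a small probability `q`, one
of two nontrivial values `c < h`, and otherwise a value that is at most a competing offer `B`, which
comes from one further bidder of known value `B` (or `B = 0`). Given that the value is nontrivial,
the probability of `h` is `ratio ± δ`, where at `ratio` the virtual value of `c` is exactly `B`.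
Hence one sign (`true`) makes a bidder of value `c` worth serving and the other sign (`false`) does
not, and a wrong decision costs `q (h - B) δ` in expectation (`HardPair.mul_critVirtual_sub`). With
a sign `θ i` for each of the bidders in `S`, these costs add up:

* The revenue of every BIC mechanism is at most its virtual surplus
  (`HardPair.rev_le_virtualSurplus`), and the optimal auction, an explicit dominant strategy
  mechanism (`PriorityAuction`), attains its virtual surplus and maximizes it pointwise. On the
  disjoint events that exactly one bidder is nontrivial, and has value `c`, the difference of the
  surpluses is the cost of the decision (`HardPair.sum_allocErr_le_loss`). So a nearly optimal
  mechanism decides correctly for most bidders.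
* The decision about bidder `i` is a statistic of the samples whose definition does not involve
  `θ`. The two signs of bidder `i` have chi-square divergence of order `q δ²`, and the second moment
  of the likelihood ratio of `m` samples is multiplicative, so that with `m q δ²` small no statistic
  tells them apart (`abs_integral_law_sub_le`). Averaging over all sign vectors (`exists_sum_ge`),
  some `θ` leaves a constant fraction of wrong decisions. This gives
  `HardPair.one_tenth_lt_mul_chi`: the number of samples is at least of order `1 / (q δ²)`.

It remains to choose the parameters, with `k` nontrivial bidders, `k ≈ n`:

* regular: values `0, 1, 2`, `q ≈ ε / k`, `δ ≈ ε`, `B ≈ ε` (for `n = 1`, `B = 0`);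
* MHR: a geometric distribution up to its `1 / n` quantile `K ≈ log n`, then `c = K`, `h = K + 1`,
  and `δ ≈ ε log n`;
* values in `[1, H]`: `q ≈ 1 / (k H)`, `δ ≈ ε`; for `n = 1` instead `q = 1`, the values `1` and `H`,
  and `δ ≈ ε / H`;
* values in `[0, 1]`: values `0, 1/2, 1`, `q ≈ 1 / n`, `δ ≈ ε`.
-/

/-! ### Product measures -/

section ProductMeasures

variable {ι : Type*} [Fintype ι]

/-- Resampling one coordinate of a product distribution does not change it. -/
theorem measurePreserving_update_pi [DecidableEq ι] {α : ι → Type*} [∀ j, MeasurableSpace (α j)]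
    (μ : ∀ j, Measure (α j)) [∀ j, IsProbabilityMeasure (μ j)] (i : ι) :
    MeasurePreserving (fun p : α i × (∀ j, α j) => Function.update p.2 i p.1)
      ((μ i).prod (Measure.pi μ)) (Measure.pi μ) := by
  have hm : Measurable (fun p : α i × (∀ j, α j) => Function.update p.2 i p.1) := by
    refine measurable_pi_iff.2 fun j => ?_
    by_cases h : j = i
    · subst h; simpa using measurable_fst
    · simp only [Function.update_of_ne h]; fun_prop
  refine ⟨hm, (Measure.pi_eq fun s hs => ?_).symm⟩
  rw [Measure.map_apply hm (MeasurableSet.univ_pi hs)]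
  have : (fun p : α i × (∀ j, α j) => Function.update p.2 i p.1) ⁻¹' (univ.pi s)
      = s i ×ˢ univ.pi (Function.update s i univ) := by
    ext ⟨t, w⟩
    simp only [mem_preimage, mem_univ_pi, mem_prod]
    constructor
    · intro h
      refine ⟨by simpa using h i, fun j => ?_⟩
      by_cases hj : j = i
      · subst hj; simp
      · simpa [Function.update_of_ne hj] using h j
    · rintro ⟨h1, h2⟩ j
      by_cases hj : j = i
      · subst hj; simpa using h1
      · simpa [Function.update_of_ne hj] using h2 j
  rw [this, Measure.prod_prod, Measure.pi_pi, ← Finset.mul_prod_erase _ _ (Finset.mem_univ i),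
    ← Finset.mul_prod_erase Finset.univ (fun j => μ j (s j)) (Finset.mem_univ i)]
  simp only [Function.update_self, measure_univ, one_mul]
  congr 1
  exact Finset.prod_congr rfl fun j hj => by
    rw [Function.update_of_ne (Finset.ne_of_mem_erase hj)]

theorem pi_withDensity {α : ι → Type*} [∀ j, MeasurableSpace (α j)]
    (μ : ∀ j, Measure (α j)) [∀ j, IsProbabilityMeasure (μ j)]
    {f : ∀ j, α j → ENNReal} (hf : ∀ j, Measurable (f j))
    [∀ j, SigmaFinite ((μ j).withDensity (f j))] :
    Measure.pi (fun j => (μ j).withDensity (f j))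
      = (Measure.pi μ).withDensity fun x => ∏ j, f j (x j) := by
  refine Measure.pi_eq fun s hs => ?_
  have hind : ∀ x : ∀ j, α j, (univ.pi s).indicator (fun x => ∏ j, f j (x j)) x
      = ∏ j, (s j).indicator (f j) (x j) := by
    intro x
    by_cases hx : x ∈ univ.pi s
    · rw [indicator_of_mem hx]
      exact Finset.prod_congr rfl fun j _ => (indicator_of_mem (hx j (mem_univ j)) _).symm
    · rw [indicator_of_notMem hx]
      obtain ⟨j, hj⟩ : ∃ j, x j ∉ s j := by simpa [mem_univ_pi] using hx
      exact (Finset.prod_eq_zero (Finset.mem_univ j) (indicator_of_notMem hj _)).symm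
  have hmi : ∀ j, Measurable ((s j).indicator (f j)) := fun j => (hf j).indicator (hs j)
  rw [withDensity_apply _ (MeasurableSet.univ_pi hs),
    ← lintegral_indicator (MeasurableSet.univ_pi hs), lintegral_congr hind]
  have h := ProbabilityTheory.lintegral_prod_eq_prod_lintegral_of_indepFun Finset.univ
    (fun j (x : ∀ j, α j) => (s j).indicator (f j) (x j))
    (ProbabilityTheory.iIndepFun_pi (μ := μ) fun j => (hmi j).aemeasurable)
    (fun j => (hmi j).comp (measurable_pi_apply j))
  rw [h]
  refine Finset.prod_congr rfl fun j _ => ?_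
  rw [withDensity_apply _ (hs j), ← lintegral_indicator (hs j)]
  exact (measurePreserving_eval μ j).lintegral_comp (hmi j)

theorem pi_smul_measure {α : ι → Type*} [∀ j, MeasurableSpace (α j)]
    (μ : ∀ j, Measure (α j)) [∀ j, IsProbabilityMeasure (μ j)] (κ : ι → NNReal) :
    Measure.pi (fun j => κ j • μ j) = (∏ j, κ j) • Measure.pi μ := by
  refine Measure.pi_eq fun s _ => ?_
  simp only [Measure.smul_apply, Measure.pi_pi]
  simp [Finset.prod_mul_distrib, ENNReal.smul_def]

end ProductMeasures

/-! ### Change of measure and the second moment -/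

theorem withDensity_dirac_real (f : ℝ → ENNReal) (a : ℝ) :
    (Measure.dirac a).withDensity f = f a • Measure.dirac a := by
  have h : f =ᵐ[Measure.dirac a] fun _ => f a := by
    rw [Filter.EventuallyEq, ae_dirac_eq]; exact rfl
  rw [withDensity_congr_ae h, withDensity_const]

/-- If the likelihood ratio of two probability laws has second moment at most `1 + s²`, then the
mean of a `[0, 1]`-valued statistic changes by at most `s`. -/
theorem abs_integral_withDensity_sub_le {α : Type*} [MeasurableSpace α] {P : Measure α}
    [IsProbabilityMeasure P] {g : α → ℝ} (hg : Measurable g) (hg0 : ∀ a, 0 ≤ g a) {C : ℝ}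
    (hgC : ∀ a, g a ≤ C) (hg1 : ∫ a, g a ∂P = 1) {s : ℝ} (hs : 0 < s)
    (hg2 : ∫ a, g a ^ 2 ∂P ≤ 1 + s ^ 2) {X : α → ℝ} (hX : Measurable X)
    (hX0 : ∀ a, 0 ≤ X a) (hX1 : ∀ a, X a ≤ 1) :
    |∫ a, X a ∂(P.withDensity fun a => ENNReal.ofReal (g a)) - ∫ a, X a ∂P| ≤ s := by
  have hb : ∀ f : α → ℝ, Measurable f → ∀ K : ℝ, (∀ a, |f a| ≤ K) → Integrable f P :=
    fun f hf K hK => Integrable.of_bound hf.aestronglyMeasurable K (.of_forall fun a => hK a)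
  have hiX : Integrable X P := hb X hX 1 fun a => abs_le.2 ⟨by linarith [hX0 a], hX1 a⟩
  have hig : Integrable g P := hb g hg C fun a => abs_le.2 ⟨by linarith [hg0 a, hgC a], hgC a⟩
  have hig2 : Integrable (fun a => g a ^ 2) P := hb _ (by fun_prop) (C ^ 2) fun a => by
    rw [abs_of_nonneg (sq_nonneg _)]
    exact pow_le_pow_left₀ (hg0 a) (hgC a) 2
  have higX : Integrable (fun a => g a * X a) P := hb _ (by fun_prop) C fun a => by
    rw [abs_of_nonneg (mul_nonneg (hg0 a) (hX0 a))]
    nlinarith [hg0 a, hgC a, hX0 a, hX1 a]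
  have e1 : ∫ a, X a ∂(P.withDensity fun a => ENNReal.ofReal (g a)) = ∫ a, g a * X a ∂P := by
    rw [integral_withDensity_eq_integral_toReal_smul (by fun_prop) (by simp)]
    refine integral_congr_ae (.of_forall fun a => ?_)
    simp [ENNReal.toReal_ofReal (hg0 a)]
  rw [e1, ← integral_sub higX hiX]
  refine (abs_integral_le_integral_abs).trans ?_
  -- `|g - 1| ≤ ((g - 1)² / s + s) / 2`, and `∫ (g - 1)² = ∫ g² - 1 ≤ s²`
  have hle : ∀ a, |g a * X a - X a| ≤ (g a ^ 2 - 2 * g a + 1) * (1 / (2 * s)) + s / 2 := by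
    intro a
    have h1 : |g a * X a - X a| ≤ |g a - 1| := by
      rw [show g a * X a - X a = (g a - 1) * X a by ring, abs_mul, abs_of_nonneg (hX0 a)]
      exact mul_le_of_le_one_right (abs_nonneg _) (hX1 a)
    refine h1.trans ?_
    rw [← sub_nonneg]
    have : (g a ^ 2 - 2 * g a + 1) * (1 / (2 * s)) + s / 2 - |g a - 1|
        = (|g a - 1| - s) ^ 2 / (2 * s) := by
      field_simp
      have := sq_abs (g a - 1)
      nlinarith
    rw [this]; positivity
  have hi0 : Integrable (fun a => g a ^ 2 - 2 * g a) P := hig2.sub (hig.const_mul 2)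
  have hi1 : Integrable (fun a => g a ^ 2 - 2 * g a + 1) P := hi0.add (integrable_const 1)
  have hsum : ∫ a, ((g a ^ 2 - 2 * g a + 1) * (1 / (2 * s)) + s / 2) ∂P
      = (∫ a, g a ^ 2 ∂P - 1) * (1 / (2 * s)) + s / 2 := by
    rw [integral_add (hi1.mul_const _) (integrable_const _), integral_mul_const,
      integral_add hi0 (integrable_const 1),
      integral_sub hig2 (hig.const_mul 2), integral_const_mul, hg1]
    simp; left; ring
  refine (integral_mono (higX.sub hiX).abs
    ((hi1.mul_const _).add (integrable_const _)) hle).trans ?_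
  simp only [Pi.add_apply]
  rw [hsum]
  have : (∫ a, g a ^ 2 ∂P - 1) * (1 / (2 * s)) ≤ s ^ 2 * (1 / (2 * s)) := by
    gcongr; linarith
  refine (add_le_add_left this _).trans (le_of_eq ?_)
  field_simp; ring

instance {n : ℕ} (D : Fin n → ProbabilityMeasure ℝ) : IsProbabilityMeasure (prior D) := by
  unfold prior; infer_instance

instance {n m : ℕ} (A : LearningAlgorithm n m) (D : Fin n → ProbabilityMeasure ℝ) :
    IsProbabilityMeasure (A.law D) := by
  unfold LearningAlgorithm.law; infer_instance

theorem prior_eq_withDensity {n : ℕ} {D D' : Fin n → ProbabilityMeasure ℝ} {i : Fin n}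
    (hD : ∀ j, j ≠ i → D' j = D j) {g : ℝ → ℝ} (hg : Measurable g)
    (hDg : (D' i : Measure ℝ) = (D i : Measure ℝ).withDensity fun t => ENNReal.ofReal (g t)) :
    prior D' = (prior D).withDensity fun v => ENNReal.ofReal (g (v i)) := by
  let f : Fin n → ℝ → ENNReal := fun j => if j = i then fun t => ENNReal.ofReal (g t) else 1
  have hf : ∀ j, Measurable (f j) := fun j => by
    by_cases h : j = i
    · simp only [f, h, if_true]; fun_prop
    · simp only [f, h, if_false]; exact measurable_one
  have hDf : ∀ j, (D' j : Measure ℝ) = (D j : Measure ℝ).withDensity (f j) := fun j => by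
    by_cases h : j = i
    · subst h; simpa [f] using hDg
    · simp [f, h, hD j h]
  have : ∀ j, SigmaFinite ((D j : Measure ℝ).withDensity (f j)) := fun j => by
    rw [← hDf j]; infer_instance
  unfold prior
  rw [show (fun j => (D' j : Measure ℝ)) = fun j => (D j : Measure ℝ).withDensity (f j) from
    funext hDf, pi_withDensity _ hf]
  congr 1
  funext v
  rw [← Finset.mul_prod_erase _ _ (Finset.mem_univ i), Finset.prod_eq_one]
  · simp [f]
  · intro j hj
    simp [f, Finset.ne_of_mem_erase hj]

/-- Changing the value distribution of one bidder changes the law of the samples by the product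
of the likelihood ratios of the samples. -/
theorem law_eq_withDensity {n m : ℕ} (A : LearningAlgorithm n m)
    {D D' : Fin n → ProbabilityMeasure ℝ} {i : Fin n}
    (hD : ∀ j, j ≠ i → D' j = D j) {g : ℝ → ℝ} (hg : Measurable g) (hg0 : ∀ t, 0 ≤ g t)
    (hDg : (D' i : Measure ℝ) = (D i : Measure ℝ).withDensity fun t => ENNReal.ofReal (g t)) :
    A.law D' = (A.law D).withDensity fun z => ENNReal.ofReal (∏ k, g (z.1 k i)) := by
  have hp := prior_eq_withDensity hD hg hDg
  have : SigmaFinite ((prior D).withDensity fun v => ENNReal.ofReal (g (v i))) := by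
    rw [← hp]; infer_instance
  unfold LearningAlgorithm.law
  rw [hp, pi_withDensity (fun _ : Fin m => prior D)
    (f := fun _ v => ENNReal.ofReal (g (v i))) fun _ => by fun_prop,
    prod_withDensity_left (by fun_prop)]
  congr 1
  funext z
  rw [ENNReal.ofReal_prod_of_nonneg fun k _ => hg0 _]

theorem integral_law_prod_eq_pow {n m : ℕ} (A : LearningAlgorithm n m)
    (D : Fin n → ProbabilityMeasure ℝ) (i : Fin n) {f : ℝ → ℝ} (hf : Measurable f) :
    ∫ z, ∏ k, f (z.1 k i) ∂(A.law D) = (∫ t, f t ∂(D i : Measure ℝ)) ^ m := by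
  unfold LearningAlgorithm.law
  rw [integral_fun_fst (f := fun y : Fin m → Fin n → ℝ => ∏ k, f (y k i)),
    integral_fintype_prod_eq_pow (fun v : Fin n → ℝ => f (v i))]
  unfold prior
  have h := integral_comp_eval (μ := fun j => (D j : Measure ℝ)) (i := i) (f := f) (by fun_prop)
  rw [h]
  simp

/-- One marginal with chi-square divergence `χ` cannot be told apart from `m` samples if
`m χ ≤ 1/10`: the mean of a `[0, 1]`-valued statistic moves by at most `2/5`. -/
theorem abs_integral_law_sub_le {n m : ℕ} (A : LearningAlgorithm n m)
    {D D' : Fin n → ProbabilityMeasure ℝ} {i : Fin n}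
    (hD : ∀ j, j ≠ i → D' j = D j) {g : ℝ → ℝ} (hg : Measurable g) (hg0 : ∀ t, 0 ≤ g t) {C : ℝ}
    (hgC : ∀ t, g t ≤ C)
    (hDg : (D' i : Measure ℝ) = (D i : Measure ℝ).withDensity fun t => ENNReal.ofReal (g t))
    {χ : ℝ} (hg2 : ∫ t, g t ^ 2 ∂(D i : Measure ℝ) ≤ 1 + χ) (hm : m * χ ≤ 1 / 10)
    {X : (Fin m → Fin n → ℝ) × A.Seed → ℝ} (hX : Measurable X)
    (hX0 : ∀ z, 0 ≤ X z) (hX1 : ∀ z, X z ≤ 1) :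
    |∫ z, X z ∂(A.law D') - ∫ z, X z ∂(A.law D)| ≤ 2 / 5 := by
  rw [law_eq_withDensity A hD hg hg0 hDg]
  have hone : ∫ t, g t ∂(D i : Measure ℝ) = 1 := by
    have h1 : ∫ _t, (1 : ℝ) ∂(D' i : Measure ℝ) = 1 := by simp
    rw [hDg, integral_withDensity_eq_integral_toReal_smul (by fun_prop) (by simp)] at h1
    rw [← h1]
    exact integral_congr_ae (.of_forall fun t => by simp [ENNReal.toReal_ofReal (hg0 t)])
  have hprod := integral_law_prod_eq_pow A D i hg
  have hsq := integral_law_prod_eq_pow A D i (f := fun t => g t ^ 2) (by fun_prop)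
  refine abs_integral_withDensity_sub_le (by fun_prop)
    (fun z => Finset.prod_nonneg fun k _ => hg0 _) (C := C ^ m) (fun z => ?_)
    (by rw [hprod, hone, one_pow]) (by norm_num) ?_ hX hX0 hX1
  · refine (Finset.prod_le_prod (fun k _ => hg0 _) fun k _ => hgC _).trans ?_
    simp
  · simp_rw [← Finset.prod_pow]
    rw [hsq]
    have h0 : 0 ≤ ∫ t, g t ^ 2 ∂(D i : Measure ℝ) := integral_nonneg fun t => sq_nonneg _
    have h1 : (∫ t, g t ^ 2 ∂(D i : Measure ℝ)) ^ m ≤ Real.exp (1 / 10) := by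
      calc (∫ t, g t ^ 2 ∂(D i : Measure ℝ)) ^ m ≤ (Real.exp χ) ^ m := by
            gcongr
            linarith [Real.add_one_le_exp χ]
        _ = Real.exp (m * χ) := by rw [← Real.exp_nat_mul]
        _ ≤ _ := Real.exp_le_exp.2 hm
    have h2 : Real.exp (1 / 10) ≤ 1 + (2 / 5) ^ 2 := by
      have := Real.abs_exp_sub_one_sub_id_le (x := 1 / 10) (by norm_num)
      have := (abs_le.1 this).2
      norm_num at this ⊢
      linarith
    exact h1.trans h2

/-! ### Interim quantities -/

section Interim

variable {n : ℕ} (M : Mechanism n) (D : Fin n → ProbabilityMeasure ℝ)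

theorem Mechanism.alloc_le_one (b : Fin n → ℝ) (i : Fin n) : M.alloc b i ≤ 1 :=
  (Finset.single_le_sum (fun j _ => M.alloc_nonneg b j) (Finset.mem_univ i)).trans
    (M.sum_alloc_le_one b)

/-- Expected allocation of bidder `i` at the bid `t` when the other bidders are truthful. -/
noncomputable def interimAlloc (i : Fin n) (t : ℝ) : ℝ :=
  ∫ w, M.alloc (Function.update w i t) i ∂(prior D)

/-- Expected payment of bidder `i` at the bid `t` when the other bidders are truthful. -/
noncomputable def interimPay (i : Fin n) (t : ℝ) : ℝ :=
  ∫ w, M.pay (Function.update w i t) i ∂(prior D)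

theorem interimUtility_eq (i : Fin n) (v b : ℝ) :
    interimUtility M D i v b = v * interimAlloc M D i b - interimPay M D i b := rfl

theorem interimAlloc_nonneg (i : Fin n) (t : ℝ) : 0 ≤ interimAlloc M D i t :=
  integral_nonneg fun _ => M.alloc_nonneg _ _

theorem integral_prior_eq_integral_update {F : (Fin n → ℝ) → ℝ} (hF : Integrable F (prior D))
    (i : Fin n) :
    Integrable (fun t => ∫ w, F (Function.update w i t) ∂(prior D)) (D i : Measure ℝ) ∧
      ∫ v, F v ∂(prior D) = ∫ t, ∫ w, F (Function.update w i t) ∂(prior D) ∂(D i : Measure ℝ) := by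
  have hmp := measurePreserving_update_pi (fun j => (D j : Measure ℝ)) i
  have hi : Integrable (fun p : ℝ × (Fin n → ℝ) => F (Function.update p.2 i p.1))
      ((D i : Measure ℝ).prod (prior D)) := hmp.integrable_comp_of_integrable hF
  refine ⟨hi.integral_prod_left, ?_⟩
  rw [← integral_prod _ hi]
  have hF' : AEStronglyMeasurable F
      (Measure.map (fun p : ℝ × (Fin n → ℝ) => Function.update p.2 i p.1)
        ((D i : Measure ℝ).prod (prior D))) := by
    have := hmp.map_eq
    unfold prior at hF ⊢
    rw [this]; exact hF.aestronglyMeasurable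
  rw [← integral_map hmp.measurable.aemeasurable hF']
  congr 1
  exact hmp.map_eq.symm

theorem integrable_of_abs_le {α : Type*} [MeasurableSpace α] {μ : Measure α} [IsFiniteMeasure μ]
    {f : α → ℝ} (hf : Measurable f) (K : ℝ) (hK : ∀ a, |f a| ≤ K) : Integrable f μ :=
  Integrable.of_bound hf.aestronglyMeasurable K (.of_forall fun a => hK a)

theorem integrable_weighted_alloc {f : ℝ → ℝ} (hf : Measurable f) {K : ℝ} (hK : ∀ t, |f t| ≤ K)
    (i : Fin n) {μ : Measure (Fin n → ℝ)} [IsFiniteMeasure μ] :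
    Integrable (fun v => f (v i) * M.alloc v i) μ := by
  refine integrable_of_abs_le ((hf.comp (measurable_pi_apply i)).mul (M.measurable_alloc i)) K
    fun v => ?_
  rw [abs_mul, abs_of_nonneg (M.alloc_nonneg v i)]
  exact (mul_le_of_le_one_right (abs_nonneg _) (M.alloc_le_one v i)).trans (hK _)

theorem integrable_alloc (i : Fin n) {μ : Measure (Fin n → ℝ)} [IsFiniteMeasure μ] :
    Integrable (fun v => M.alloc v i) μ := by
  simpa using integrable_weighted_alloc M (f := fun _ => 1) (by fun_prop) (K := 1) (by simp) i
    (μ := μ)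

theorem integral_weighted_alloc {f : ℝ → ℝ} (hf : Measurable f) {K : ℝ} (hK : ∀ t, |f t| ≤ K)
    (i : Fin n) :
    Integrable (fun t => f t * interimAlloc M D i t) (D i : Measure ℝ) ∧
    ∫ v, f (v i) * M.alloc v i ∂(prior D)
      = ∫ t, f t * interimAlloc M D i t ∂(D i : Measure ℝ) := by
  have h := integral_prior_eq_integral_update D (integrable_weighted_alloc M hf hK i) i
  simp only [Function.update_self, integral_const_mul] at h
  exact h

end Interim

/-! ### The hard value distributions -/

/-- A pair of value distributions that differ in the odds between a critical value `c` and a top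
value `h`. A bidder has a nontrivial value (`c` or `h`) with probability `q`, and otherwise a value
drawn from `base`, which is at most the competing offer `B`. At the odds `ratio` the virtual value
of `c` is exactly `B`; shifting the conditional probability of `h` by `δ` moves it across `B`. -/
structure HardPair where
  base : ProbabilityMeasure ℝ
  B : ℝ
  c : ℝ
  h : ℝ
  q : ℝ
  δ : ℝ
  B_nonneg : 0 ≤ B
  B_lt : B < c
  c_lt : c < h
  q_pos : 0 < q
  q_le_one : q ≤ 1
  δ_pos : 0 < δ
  δ_lt : δ < (c - B) / (h - B)
  lt_one : (c - B) / (h - B) + δ < 1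
  base_Icc : (base : Measure ℝ) (Icc 0 B) = 1

namespace HardPair

variable (P : HardPair)

/-- The conditional probability of `h` given a nontrivial value at which `c` has virtual
value `B`. -/
noncomputable def ratio : ℝ := (P.c - P.B) / (P.h - P.B)

/-- The conditional probability of `h` given a nontrivial value: for `true` it is lowered by `δ`,
so that the virtual value of `c` exceeds `B`; for `false` it is raised. -/
noncomputable def top (θ : Bool) : ℝ := if θ then P.ratio - P.δ else P.ratio + P.δ

theorem top_pos (θ : Bool) : 0 < P.top θ := by
  have := P.δ_lt; have := P.δ_pos
  cases θ <;> simp only [top, ratio] <;> norm_num <;> linarith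

theorem top_lt_one (θ : Bool) : P.top θ < 1 := by
  have := P.lt_one; have := P.δ_pos
  cases θ <;> simp only [top, ratio] <;> norm_num <;> linarith

theorem top_le (θ : Bool) : P.top θ ≤ P.ratio + P.δ := by
  have := P.δ_pos
  cases θ <;> simp [top]; linarith

theorem c_pos : 0 < P.c := P.B_nonneg.trans_lt P.B_lt

theorem h_pos : 0 < P.h := P.c_pos.trans P.c_lt

theorem ratio_mul : P.ratio * (P.h - P.B) = P.c - P.B := by
  have := P.B_lt; have := P.c_lt
  unfold ratio; field_simp [show P.h - P.B ≠ 0 by linarith]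

/-- The value distribution with the odds determined by `θ`. -/
noncomputable def law (θ : Bool) : ProbabilityMeasure ℝ :=
  ⟨(1 - P.q).toNNReal • (P.base : Measure ℝ) +
      ((P.q * (1 - P.top θ)).toNNReal • Measure.dirac P.c +
        (P.q * P.top θ).toNNReal • Measure.dirac P.h), ⟨by
    have h1 := P.q_pos; have h2 := P.q_le_one; have h3 := P.top_pos θ; have h4 := P.top_lt_one θ
    simp only [Measure.add_apply, Measure.smul_apply, measure_univ, ENNReal.smul_def, smul_eq_mul,
      mul_one]
    norm_cast
    rw [← Real.toNNReal_add (by nlinarith) (by nlinarith), ← Real.toNNReal_add (by nlinarith)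
      (by nlinarith)]
    rw [show 1 - P.q + (P.q * (1 - P.top θ) + P.q * P.top θ) = 1 by ring]; simp⟩⟩

theorem coe_law (θ : Bool) : (P.law θ : Measure ℝ) = (1 - P.q).toNNReal • (P.base : Measure ℝ) +
      ((P.q * (1 - P.top θ)).toNNReal • Measure.dirac P.c +
        (P.q * P.top θ).toNNReal • Measure.dirac P.h) := rfl

theorem integral_law {θ : Bool} {f : ℝ → ℝ} (hf : Integrable f (P.law θ : Measure ℝ)) :
    Integrable f ((1 - P.q).toNNReal • (P.base : Measure ℝ)) ∧
    ∫ t, f t ∂(P.law θ : Measure ℝ) = ∫ t, f t ∂((1 - P.q).toNNReal • (P.base : Measure ℝ)) +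
      (P.q * (1 - P.top θ) * f P.c + P.q * P.top θ * f P.h) := by
  have h1 := P.q_pos; have h2 := P.q_le_one; have h3 := P.top_pos θ; have h4 := P.top_lt_one θ
  rw [coe_law] at hf ⊢
  obtain ⟨ha, hb⟩ := integrable_add_measure.1 hf
  obtain ⟨hb, hc⟩ := integrable_add_measure.1 hb
  refine ⟨ha, ?_⟩
  rw [integral_add_measure ha (hb.add_measure hc), integral_add_measure hb hc,
    integral_smul_nnreal_measure, integral_smul_nnreal_measure, integral_smul_nnreal_measure,
    integral_dirac, integral_dirac]
  simp only [NNReal.smul_def, smul_eq_mul]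
  rw [Real.coe_toNNReal (P.q * _) (by nlinarith), Real.coe_toNNReal (P.q * _) (by nlinarith)]

theorem ae_base : ∀ᵐ t ∂(P.base : Measure ℝ), t ∈ Icc 0 P.B := by
  exact (prob_compl_eq_zero_iff (μ := (P.base : Measure ℝ)) measurableSet_Icc).2 P.base_Icc

theorem ae_smul_base : ∀ᵐ t ∂((1 - P.q).toNNReal • (P.base : Measure ℝ)), t ∈ Icc 0 P.B :=
  Measure.ae_smul_measure P.ae_base _

theorem ae_law (θ : Bool) :
    ∀ᵐ t ∂(P.law θ : Measure ℝ), t ∈ Icc 0 P.B ∨ t = P.c ∨ t = P.h := by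
  rw [coe_law, ae_add_measure_iff, ae_add_measure_iff]
  refine ⟨P.ae_smul_base.mono fun t ht => Or.inl ht, ?_, ?_⟩
  · refine Measure.ae_smul_measure ?_ _
    rw [ae_dirac_eq]; exact Or.inr (Or.inl rfl)
  · refine Measure.ae_smul_measure ?_ _
    rw [ae_dirac_eq]; exact Or.inr (Or.inr rfl)

/-- The virtual value of the critical value. -/
noncomputable def critVirtual (θ : Bool) : ℝ :=
  P.c - (P.h - P.c) * P.top θ / (1 - P.top θ)

/-- An upper bound on the virtual value, exact at `c` and `h`. -/
noncomputable def virt (θ : Bool) (t : ℝ) : ℝ :=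
  if t = P.h then P.h else if t = P.c then P.critVirtual θ else P.B

theorem virt_h (θ : Bool) : P.virt θ P.h = P.h := by simp [virt]

theorem virt_c (θ : Bool) : P.virt θ P.c = P.critVirtual θ := by simp [virt, P.c_lt.ne]

theorem virt_low (θ : Bool) {t : ℝ} (ht : t < P.c) : P.virt θ t = P.B := by
  simp [virt, ht.ne, (ht.trans P.c_lt).ne]

theorem measurable_virt (θ : Bool) : Measurable (P.virt θ) :=
  Measurable.ite (measurableSet_singleton _) measurable_const
    (Measurable.ite (measurableSet_singleton _) measurable_const measurable_const)

theorem abs_virt_le (θ : Bool) (t : ℝ) : |P.virt θ t| ≤ |P.h| + |P.critVirtual θ| + |P.B| := by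
  have := abs_nonneg P.h; have := abs_nonneg P.B; have := abs_nonneg (P.critVirtual θ)
  unfold virt; split_ifs <;> linarith

theorem mul_critVirtual (θ : Bool) :
    (1 - P.top θ) * P.critVirtual θ = P.c - P.h * P.top θ := by
  have := P.top_lt_one θ
  unfold critVirtual; field_simp [show 1 - P.top θ ≠ 0 by linarith]; ring

/-- The virtual value of `c`, weighted by its probability, misses the offer `B` by exactly
`(h - B) δ`, on the side determined by `θ`. -/
theorem mul_critVirtual_sub (θ : Bool) :
    (1 - P.top θ) * (P.critVirtual θ - P.B) = (if θ then 1 else -1) * ((P.h - P.B) * P.δ) := by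
  have h1 := P.mul_critVirtual θ
  have h2 := P.ratio_mul
  rw [mul_sub, h1]
  cases θ <;> simp only [top] <;> norm_num <;> linarith

/-- The value distributions of all bidders: those in `S` are drawn from the hard pair, according
to `θ`, and the others have the value `B` for sure. -/
noncomputable def profile {n : ℕ} (S : Finset (Fin n)) (θ : Fin n → Bool) (i : Fin n) :
    ProbabilityMeasure ℝ :=
  if i ∈ S then P.law (θ i) else diracProba P.B

/-- The virtual value bounds in the profile. The known value `B` is its own virtual value. -/
noncomputable def virtAt {n : ℕ} (S : Finset (Fin n)) (θ : Fin n → Bool) (i : Fin n) (t : ℝ) : ℝ :=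
  if i ∈ S then P.virt (θ i) t else P.B

variable {n : ℕ} (S : Finset (Fin n)) (θ : Fin n → Bool)

theorem coe_profile_of_mem {i : Fin n} (hi : i ∈ S) :
    (P.profile S θ i : Measure ℝ) = P.law (θ i) := by simp [profile, hi]

theorem coe_profile_of_notMem {i : Fin n} (hi : i ∉ S) :
    (P.profile S θ i : Measure ℝ) = Measure.dirac P.B := by simp [profile, hi, diracProba]

theorem measurable_virtAt (i : Fin n) : Measurable (P.virtAt S θ i) := by
  by_cases h : i ∈ S
  · rw [show P.virtAt S θ i = P.virt (θ i) from funext fun t => by simp [virtAt, h]]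
    exact P.measurable_virt (θ i)
  · rw [show P.virtAt S θ i = fun _ => P.B from funext fun t => by simp [virtAt, h]]
    exact measurable_const

theorem exists_abs_virtAt_le : ∃ K, 0 ≤ K ∧ ∀ i t, |P.virtAt S θ i t| ≤ K := by
  refine ⟨|P.h| + (|P.critVirtual true| + |P.critVirtual false|) + |P.B|, by positivity,
    fun i t => ?_⟩
  have := abs_nonneg P.h; have := abs_nonneg P.B
  have := abs_nonneg (P.critVirtual true); have := abs_nonneg (P.critVirtual false)
  unfold virtAt; split_ifs
  · have := P.abs_virt_le (θ i) t
    cases h : θ i <;> rw [h] at this <;> linarith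
  · linarith

/-- The virtual surplus of a mechanism on the profile. -/
noncomputable def virtualSurplus (M : Mechanism n) : ℝ :=
  ∫ v, ∑ i, P.virtAt S θ i (v i) * M.alloc v i ∂(prior (P.profile S θ))

theorem integrable_virtAt_mul_alloc (M : Mechanism n) (i : Fin n) :
    Integrable (fun v => P.virtAt S θ i (v i) * M.alloc v i) (prior (P.profile S θ)) := by
  obtain ⟨K, -, hK⟩ := P.exists_abs_virtAt_le S θ
  exact integrable_weighted_alloc M (P.measurable_virtAt S θ i) (hK i) i

theorem virtualSurplus_eq_sum (M : Mechanism n) :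
    P.virtualSurplus S θ M
      = ∑ i, ∫ v, P.virtAt S θ i (v i) * M.alloc v i ∂(prior (P.profile S θ)) :=
  integral_finsetSum _ fun i _ => P.integrable_virtAt_mul_alloc S θ M i

/-- The virtual surplus of a bidder in `S`, with `mul_critVirtual` applied at `c`. -/
theorem integral_virtAt_of_mem (M : Mechanism n) {i : Fin n} (hi : i ∈ S) :
    Integrable (fun t => P.B * interimAlloc M (P.profile S θ) i t)
        ((1 - P.q).toNNReal • (P.base : Measure ℝ)) ∧
    ∫ v, P.virtAt S θ i (v i) * M.alloc v i ∂(prior (P.profile S θ))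
      = ∫ t, P.B * interimAlloc M (P.profile S θ) i t
          ∂((1 - P.q).toNNReal • (P.base : Measure ℝ)) +
        P.q * ((P.c - P.h * P.top (θ i)) * interimAlloc M (P.profile S θ) i P.c +
          P.top (θ i) * P.h * interimAlloc M (P.profile S θ) i P.h) := by
  obtain ⟨K, -, hK⟩ := P.exists_abs_virtAt_le S θ
  have h := integral_weighted_alloc M (P.profile S θ) (P.measurable_virtAt S θ i) (hK i) i
  rw [coe_profile_of_mem P S θ hi] at h
  have h2 := P.integral_law h.1
  have hcongr : (fun t => P.virtAt S θ i t * interimAlloc M (P.profile S θ) i t)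
      =ᵐ[(1 - P.q).toNNReal • (P.base : Measure ℝ)]
      fun t => P.B * interimAlloc M (P.profile S θ) i t := by
    filter_upwards [P.ae_smul_base] with t ht
    simp [virtAt, hi, P.virt_low _ (ht.2.trans_lt P.B_lt)]
  refine ⟨h2.1.congr hcongr, ?_⟩
  rw [h.2, h2.2, integral_congr_ae hcongr]
  simp only [virtAt, hi, if_true, virt_c, virt_h]
  rw [← P.mul_critVirtual]
  ring

theorem integral_virtAt_of_notMem (M : Mechanism n) {i : Fin n} (hi : i ∉ S) :
    ∫ v, P.virtAt S θ i (v i) * M.alloc v i ∂(prior (P.profile S θ))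
      = P.B * interimAlloc M (P.profile S θ) i P.B := by
  obtain ⟨K, -, hK⟩ := P.exists_abs_virtAt_le S θ
  have h := integral_weighted_alloc M (P.profile S θ) (P.measurable_virtAt S θ i) (hK i) i
  rw [coe_profile_of_notMem P S θ hi] at h
  rw [h.2, integral_dirac]
  simp [virtAt, hi]

/-- The revenue of a BIC mechanism is at most its virtual surplus: the payment at `h` is limited by
the temptation to bid `c` instead, all other payments by individual rationality. -/
theorem rev_le_virtualSurplus {M : Mechanism n} (hM : IsBIC M (P.profile S θ)) :
    Rev M (P.profile S θ) ≤ P.virtualSurplus S θ M := by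
  rw [virtualSurplus_eq_sum]
  unfold Rev
  rw [integral_finsetSum _ fun i _ => hM.integrable_pay i]
  refine Finset.sum_le_sum fun i _ => ?_
  have hpay : ∀ t, 0 ≤ t → interimPay M (P.profile S θ) i t
      ≤ t * interimAlloc M (P.profile S θ) i t := fun t ht => by
    have := hM.rational i t ht
    rw [interimUtility_eq] at this; linarith
  have hY := integral_prior_eq_integral_update (P.profile S θ) (hM.integrable_pay i) i
  rw [hY.2]
  by_cases hi : i ∈ S
  · obtain ⟨hX, hX'⟩ := P.integral_virtAt_of_mem S θ M hi
    rw [hX']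
    have hYi := hY.1
    rw [coe_profile_of_mem P S θ hi] at hYi ⊢
    have hY2 := P.integral_law hYi
    rw [hY2.2]
    refine add_le_add ?_ ?_
    · refine integral_mono_ae hY2.1 hX ?_
      filter_upwards [P.ae_smul_base] with t ht
      exact (hpay t ht.1).trans
        (mul_le_mul_of_nonneg_right ht.2 (interimAlloc_nonneg M _ i t))
    · have h1 := hpay P.c P.c_pos.le
      have h2 := hM.truthful i P.h P.c P.h_pos.le P.c_pos.le
      simp only [interimUtility_eq] at h2
      have h3 := mul_le_mul_of_nonneg_left h2 (P.top_pos (θ i)).le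
      have : (1 - P.top (θ i)) * interimPay M (P.profile S θ) i P.c +
          P.top (θ i) * interimPay M (P.profile S θ) i P.h ≤
          (P.c - P.h * P.top (θ i)) * interimAlloc M (P.profile S θ) i P.c +
          P.top (θ i) * P.h * interimAlloc M (P.profile S θ) i P.h := by linarith
      have h4 := mul_le_mul_of_nonneg_left this P.q_pos.le
      refine le_trans (le_of_eq ?_) h4
      simp only [interimPay]; ring
  · rw [P.integral_virtAt_of_notMem S θ M hi, coe_profile_of_notMem P S θ hi, integral_dirac]
    exact hpay P.B P.B_nonneg

/-- The converse of `rev_le_virtualSurplus` for mechanisms whose payments are as high as the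
incentive constraints allow. -/
theorem rev_eq_virtualSurplus {M : Mechanism n}
    (hM : ∀ i, Integrable (fun v => M.pay v i) (prior (P.profile S θ)))
    (hlow : ∀ i ∈ S, ∀ w, ∀ t, t < P.c → M.alloc (Function.update w i t) i = 0 ∧
      M.pay (Function.update w i t) i = 0)
    (hc : ∀ i ∈ S, ∀ w, M.pay (Function.update w i P.c) i
      = P.c * M.alloc (Function.update w i P.c) i)
    (hh : ∀ i ∈ S, ∀ w, M.pay (Function.update w i P.h) i
      = P.c * M.alloc (Function.update w i P.c) i +
        P.h * (M.alloc (Function.update w i P.h) i - M.alloc (Function.update w i P.c) i))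
    (hB : ∀ i ∉ S, ∀ w, M.pay (Function.update w i P.B) i
      = P.B * M.alloc (Function.update w i P.B) i) :
    Rev M (P.profile S θ) = P.virtualSurplus S θ M := by
  rw [virtualSurplus_eq_sum]
  unfold Rev
  rw [integral_finsetSum _ fun i _ => hM i]
  refine Finset.sum_congr rfl fun i _ => ?_
  have hY := integral_prior_eq_integral_update (P.profile S θ) (hM i) i
  have hint : ∀ t, Integrable (fun w => M.alloc (Function.update w i t) i)
      (prior (P.profile S θ)) := fun t =>
    integrable_of_abs_le ((M.measurable_alloc i).comp (measurable_update_left)) 1 fun w => by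
      rw [abs_of_nonneg (M.alloc_nonneg _ _)]; exact M.alloc_le_one _ _
  rw [hY.2]
  by_cases hi : i ∈ S
  · obtain ⟨hX, hX'⟩ := P.integral_virtAt_of_mem S θ M hi
    rw [hX']
    have hYi := hY.1
    rw [coe_profile_of_mem P S θ hi] at hYi ⊢
    have hY2 := P.integral_law hYi
    rw [hY2.2]
    congr 1
    · refine integral_congr_ae ?_
      filter_upwards [P.ae_smul_base] with t ht
      have := fun w => hlow i hi w t (ht.2.trans_lt P.B_lt)
      simp [interimAlloc, this]
    · simp only [hc i hi, hh i hi]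
      have hd : Integrable (fun w => M.alloc (Function.update w i P.h) i
          - M.alloc (Function.update w i P.c) i) (prior (P.profile S θ)) := (hint _).sub (hint _)
      rw [integral_add ((hint _).const_mul _) (hd.const_mul _),
        integral_const_mul, integral_const_mul, integral_sub (hint _) (hint _)]
      simp only [interimAlloc]; ring
  · rw [P.integral_virtAt_of_notMem S θ M hi, coe_profile_of_notMem P S θ hi, integral_dirac]
    simp only [hB i hi, integral_const_mul, interimAlloc]

end HardPair

/-! ### Priority auctions -/

/-- A deterministic auction in which the bid of bidder `i` only matters through a score, which is
`0` below `lo i`, `mid i` between `lo i` and `hi i`, and `top i` from `hi i` on. The item goes to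
the bidder with the highest positive score, ties being broken by the index. -/
structure PriorityAuction (n : ℕ) where
  lo : Fin n → ℝ
  hi : Fin n → ℝ
  mid : Fin n → ℕ
  top : Fin n → ℕ
  lo_nonneg : ∀ i, 0 ≤ lo i
  lo_le_hi : ∀ i, lo i ≤ hi i
  mid_le_top : ∀ i, mid i ≤ top i

namespace PriorityAuction

variable {n : ℕ} (Q : PriorityAuction n)

/-- The score of bidder `i` at the bid `t`. -/
noncomputable def score (i : Fin n) (t : ℝ) : ℕ :=
  if t < Q.lo i then 0 else if t < Q.hi i then Q.mid i else Q.top i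

theorem measurable_score (i : Fin n) : Measurable (Q.score i) :=
  Measurable.ite measurableSet_Iio measurable_const
    (Measurable.ite measurableSet_Iio measurable_const measurable_const)

/-- Bidder `i` with score `σ` beats the bids of the other bidders. Scores and indices are compared
lexicographically, encoded as `σ * n + i`. -/
def Wins (b : Fin n → ℝ) (i : Fin n) (σ : ℕ) : Prop :=
  0 < σ ∧ ∀ j, j ≠ i → Q.score j (b j) * n + j < σ * n + i

open Classical in
/-- The indicator of `Wins`. -/
noncomputable def winInd (b : Fin n → ℝ) (i : Fin n) (σ : ℕ) : ℝ := if Q.Wins b i σ then 1 else 0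

theorem winInd_nonneg (b : Fin n → ℝ) (i : Fin n) (σ : ℕ) : 0 ≤ Q.winInd b i σ := by
  unfold winInd; split_ifs <;> norm_num

theorem winInd_le_one (b : Fin n → ℝ) (i : Fin n) (σ : ℕ) : Q.winInd b i σ ≤ 1 := by
  unfold winInd; split_ifs <;> norm_num

theorem winInd_zero (b : Fin n → ℝ) (i : Fin n) : Q.winInd b i 0 = 0 := by
  simp [winInd, Wins]

theorem winInd_mono (b : Fin n → ℝ) (i : Fin n) {σ τ : ℕ} (h : σ ≤ τ) :
    Q.winInd b i σ ≤ Q.winInd b i τ := by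
  by_cases hw : Q.Wins b i σ
  · have : Q.Wins b i τ := ⟨hw.1.trans_le h, fun j hj => (hw.2 j hj).trans_le
      (Nat.add_le_add_right (Nat.mul_le_mul_right n h) _)⟩
    simp [winInd, hw, this]
  · simp only [winInd, hw, if_false]; exact Q.winInd_nonneg b i τ

theorem winInd_update (b : Fin n → ℝ) (i : Fin n) (t : ℝ) (σ : ℕ) :
    Q.winInd (Function.update b i t) i σ = Q.winInd b i σ := by
  have : Q.Wins (Function.update b i t) i σ ↔ Q.Wins b i σ := by
    unfold Wins
    refine and_congr Iff.rfl (forall_congr' fun j => forall_congr' fun hj => ?_)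
    rw [Function.update_of_ne hj]
  unfold winInd
  by_cases h : Q.Wins b i σ
  · rw [if_pos h, if_pos (this.2 h)]
  · rw [if_neg h, if_neg (mt this.1 h)]

theorem measurable_winInd (i : Fin n) (σ : ℕ) : Measurable fun b => Q.winInd b i σ := by
  have : MeasurableSet {b | Q.Wins b i σ} := by
    have : {b | Q.Wins b i σ} = {_b : Fin n → ℝ | 0 < σ} ∩
        ⋂ j, {b : Fin n → ℝ | j ≠ i → Q.score j (b j) * n + j < σ * n + i} := by
      ext b; simp [Wins]
    rw [this]
    refine (MeasurableSet.const _).inter (MeasurableSet.iInter fun j => ?_)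
    have hf : Measurable fun b : Fin n → ℝ => Q.score j (b j) :=
      (Q.measurable_score j).comp (measurable_pi_apply j)
    exact hf (t := {k | j ≠ i → k * n + j < σ * n + i}) (MeasurableSet.of_discrete)
  exact Measurable.ite this measurable_const measurable_const

theorem sum_winInd_score_le_one (b : Fin n → ℝ) :
    ∑ i, Q.winInd b i (Q.score i (b i)) ≤ 1 := by
  by_cases h : ∃ k, Q.Wins b k (Q.score k (b k))
  · obtain ⟨k, hk⟩ := h
    rw [Finset.sum_eq_single k]
    · exact Q.winInd_le_one _ _ _
    · intro j _ hj
      have : ¬ Q.Wins b j (Q.score j (b j)) := fun hw =>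
        lt_asymm (hk.2 j hj) (hw.2 k (Ne.symm hj))
      simp [winInd, this]
    · simp
  · rw [Finset.sum_eq_zero]
    · norm_num
    · intro j _
      have : ¬ Q.Wins b j (Q.score j (b j)) := fun hw => h ⟨j, hw⟩
      simp [winInd, this]

/-- Some bidder with the largest score wins, unless all scores are zero. -/
theorem exists_wins {b : Fin n → ℝ} {j : Fin n} (hj : 0 < Q.score j (b j)) :
    ∃ k, Q.Wins b k (Q.score k (b k)) ∧ ∀ i, Q.score i (b i) ≤ Q.score k (b k) := by
  obtain ⟨k, -, hk⟩ := Finset.exists_max_image Finset.univ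
    (fun i : Fin n => Q.score i (b i) * n + i) ⟨j, Finset.mem_univ j⟩
  have hle : ∀ i, Q.score i (b i) ≤ Q.score k (b k) := fun i => by
    by_contra! hlt
    have h1 := hk i (Finset.mem_univ i)
    have h2 : (Q.score k (b k) + 1) * n ≤ Q.score i (b i) * n := Nat.mul_le_mul_right n hlt
    have h3 := k.2
    rw [add_mul, one_mul] at h2
    omega
  refine ⟨k, ⟨hj.trans_le (hle j), fun i hi => lt_of_le_of_ne (hk i (Finset.mem_univ i)) ?_⟩, hle⟩
  intro heq
  have h1 : (Q.score i (b i) * n + i) % n = (Q.score k (b k) * n + k) % n := by rw [heq]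
  rw [Nat.mul_add_mod_self_right, Nat.mul_add_mod_self_right, Nat.mod_eq_of_lt i.2,
    Nat.mod_eq_of_lt k.2] at h1
  exact hi (Fin.ext h1)

/-- The allocation, written as a step function of the own bid. -/
noncomputable def allocAt (b : Fin n → ℝ) (i : Fin n) (t : ℝ) : ℝ :=
  if t < Q.lo i then 0 else if t < Q.hi i then Q.winInd b i (Q.mid i) else Q.winInd b i (Q.top i)

/-- The payment that Myerson's payment identity assigns to the step function `allocAt`. -/
noncomputable def payAt (b : Fin n → ℝ) (i : Fin n) (t : ℝ) : ℝ :=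
  if t < Q.lo i then 0 else if t < Q.hi i then Q.lo i * Q.winInd b i (Q.mid i)
  else Q.lo i * Q.winInd b i (Q.mid i) +
    Q.hi i * (Q.winInd b i (Q.top i) - Q.winInd b i (Q.mid i))

theorem allocAt_eq (b : Fin n → ℝ) (i : Fin n) :
    Q.allocAt b i (b i) = Q.winInd b i (Q.score i (b i)) := by
  unfold allocAt score; split_ifs <;> simp [winInd_zero]

/-- The mechanism of a priority auction. -/
noncomputable def mechanism : Mechanism n where
  alloc b i := Q.allocAt b i (b i)
  pay b i := Q.payAt b i (b i)
  alloc_nonneg b i := by rw [allocAt_eq]; exact Q.winInd_nonneg _ _ _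
  sum_alloc_le_one b := by simp only [allocAt_eq]; exact Q.sum_winInd_score_le_one b
  measurable_alloc i := by
    have h := Q.measurable_winInd i
    exact Measurable.ite (measurableSet_lt (measurable_pi_apply i) measurable_const)
      measurable_const (Measurable.ite (measurableSet_lt (measurable_pi_apply i) measurable_const)
        (h _) (h _))
  measurable_pay i := by
    have h := Q.measurable_winInd i
    exact Measurable.ite (measurableSet_lt (measurable_pi_apply i) measurable_const)
      measurable_const (Measurable.ite (measurableSet_lt (measurable_pi_apply i) measurable_const)
        ((h _).const_mul _) (((h _).const_mul _).add (((h _).sub (h _)).const_mul _)))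

theorem mechanism_alloc (b : Fin n → ℝ) (i : Fin n) :
    Q.mechanism.alloc b i = Q.winInd b i (Q.score i (b i)) := Q.allocAt_eq b i

theorem mechanism_alloc_update (b : Fin n → ℝ) (i : Fin n) (t : ℝ) :
    Q.mechanism.alloc (Function.update b i t) i = Q.allocAt b i t := by
  simp [mechanism, allocAt, winInd_update]

theorem mechanism_pay_update (b : Fin n → ℝ) (i : Fin n) (t : ℝ) :
    Q.mechanism.pay (Function.update b i t) i = Q.payAt b i t := by
  simp [mechanism, payAt, winInd_update]

theorem abs_payAt_le (b : Fin n → ℝ) (i : Fin n) (t : ℝ) :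
    |Q.payAt b i t| ≤ Q.lo i + Q.hi i := by
  have h1 := Q.winInd_nonneg b i (Q.mid i)
  have h2 := Q.winInd_le_one b i (Q.top i)
  have h3 := Q.winInd_mono b i (Q.mid_le_top i)
  have h4 := Q.lo_nonneg i
  have h5 := Q.lo_le_hi i
  rw [abs_le]
  unfold payAt
  split_ifs <;> constructor <;> nlinarith

theorem utility_le (b : Fin n → ℝ) (i : Fin n) (v t : ℝ) :
    v * Q.allocAt b i t - Q.payAt b i t ≤ v * Q.allocAt b i v - Q.payAt b i v := by
  have h1 := Q.winInd_nonneg b i (Q.mid i)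
  have h3 := Q.winInd_mono b i (Q.mid_le_top i)
  have h5 := Q.lo_le_hi i
  unfold allocAt payAt
  split_ifs <;> nlinarith

theorem utility_nonneg (b : Fin n → ℝ) (i : Fin n) (v : ℝ) :
    0 ≤ v * Q.allocAt b i v - Q.payAt b i v := by
  have h1 := Q.winInd_nonneg b i (Q.mid i)
  have h3 := Q.winInd_mono b i (Q.mid_le_top i)
  have h5 := Q.lo_le_hi i
  unfold allocAt payAt
  split_ifs <;> nlinarith

theorem isBIC_mechanism (D : Fin n → ProbabilityMeasure ℝ) : IsBIC Q.mechanism D := by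
  have hpm : ∀ i t, Measurable fun w => Q.mechanism.pay (Function.update w i t) i := fun i t =>
    (Q.mechanism.measurable_pay i).comp measurable_update_left
  have ham : ∀ i t, Measurable fun w => Q.mechanism.alloc (Function.update w i t) i := fun i t =>
    (Q.mechanism.measurable_alloc i).comp measurable_update_left
  have hpi : ∀ i t, Integrable (fun w => Q.mechanism.pay (Function.update w i t) i) (prior D) :=
    fun i t => integrable_of_abs_le (hpm i t) (Q.lo i + Q.hi i) fun w => by
      rw [mechanism_pay_update]; exact Q.abs_payAt_le w i t
  have hai : ∀ i t, Integrable (fun w => Q.mechanism.alloc (Function.update w i t) i) (prior D) :=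
    fun i t => integrable_of_abs_le (ham i t) 1 fun w => by
      rw [abs_of_nonneg (Q.mechanism.alloc_nonneg _ _)]; exact Q.mechanism.alloc_le_one _ _
  have hu : ∀ i v t, interimUtility Q.mechanism D i v t
      = ∫ w, (v * Q.allocAt w i t - Q.payAt w i t) ∂(prior D) := fun i v t => by
    unfold interimUtility
    rw [← integral_const_mul, ← integral_sub ((hai i t).const_mul v) (hpi i t)]
    simp only [mechanism_alloc_update, mechanism_pay_update]
  have hui : ∀ i v t, Integrable (fun w => v * Q.allocAt w i t - Q.payAt w i t) (prior D) :=
    fun i v t => by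
      have := ((hai i t).const_mul v).sub (hpi i t)
      simp only [mechanism_alloc_update, mechanism_pay_update] at this
      exact this
  refine ⟨fun i => ?_, fun i b _ => hpi i b, fun i v b _ _ => ?_, fun i v _ => ?_⟩
  · exact integrable_of_abs_le (Q.mechanism.measurable_pay i) (Q.lo i + Q.hi i)
      fun w => Q.abs_payAt_le w i (w i)
  · rw [hu, hu]
    exact integral_mono (hui i v b) (hui i v v) fun w => Q.utility_le w i v b
  · rw [hu]
    exact integral_nonneg fun w => Q.utility_nonneg w i v

end PriorityAuction

/-! ### The optimal auction for the hard profiles -/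

namespace HardPair

variable (P : HardPair) {n : ℕ} (S : Finset (Fin n)) (θ : Fin n → Bool)

theorem critVirtual_true : P.B < P.critVirtual true := by
  have h1 := P.mul_critVirtual_sub true
  have h2 := P.top_lt_one true
  have : 0 < (P.h - P.B) * P.δ := mul_pos (by linarith [P.B_lt, P.c_lt]) P.δ_pos
  simp only [if_true, one_mul] at h1
  nlinarith

theorem critVirtual_false : P.critVirtual false < P.B := by
  have h1 := P.mul_critVirtual_sub false
  have h2 := P.top_lt_one false
  have : 0 < (P.h - P.B) * P.δ := mul_pos (by linarith [P.B_lt, P.c_lt]) P.δ_pos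
  simp at h1
  nlinarith

theorem critVirtual_le (b : Bool) : P.critVirtual b ≤ P.c := by
  unfold critVirtual
  have : 0 ≤ (P.h - P.c) * P.top b / (1 - P.top b) :=
    div_nonneg (mul_nonneg (by linarith [P.c_lt]) (P.top_pos b).le) (by linarith [P.top_lt_one b])
  linarith

/-- The revenue-optimal auction on the profile: the value `h` has priority over `c`, which is
accepted only from bidders with `θ i = true`, and this has priority over the sure value `B` of the
bidders outside `S`. -/
noncomputable def optimalAuction : PriorityAuction n where
  lo i := if i ∈ S then P.c else P.B
  hi i := if i ∈ S then P.h else P.B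
  mid i := if i ∈ S then (if θ i then 2 else 0) else 1
  top i := if i ∈ S then 3 else 1
  lo_nonneg i := by split_ifs; exacts [P.c_pos.le, P.B_nonneg]
  lo_le_hi i := by split_ifs; exacts [P.c_lt.le, le_rfl]
  mid_le_top i := by split_ifs <;> norm_num

/-- The revenue of the optimal auction. -/
noncomputable def optimalRev : ℝ := Rev (P.optimalAuction S θ).mechanism (P.profile S θ)

theorem optimalRev_eq :
    P.optimalRev S θ = P.virtualSurplus S θ (P.optimalAuction S θ).mechanism := by
  have hBc := P.B_lt
  have hch := P.c_lt
  refine P.rev_eq_virtualSurplus S θ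
    (fun i => ((P.optimalAuction S θ).isBIC_mechanism _).integrable_pay i) ?_ ?_ ?_ ?_ <;>
  intro i hi w <;>
  simp only [PriorityAuction.mechanism_alloc_update, PriorityAuction.mechanism_pay_update,
    PriorityAuction.allocAt, PriorityAuction.payAt, optimalAuction, hi, if_true, if_false]
  · intro t ht; simp [ht]
  · simp [hch]
  · simp [hch, hch.not_gt]
  · simp

theorem ae_profile : ∀ᵐ v ∂(prior (P.profile S θ)), ∀ i,
    (i ∈ S → (v i ∈ Icc 0 P.B ∨ v i = P.c ∨ v i = P.h)) ∧ (i ∉ S → v i = P.B) := by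
  rw [ae_all_iff]
  intro i
  have htend := (measurePreserving_eval (fun j => (P.profile S θ j : Measure ℝ))
    i).quasiMeasurePreserving.tendsto_ae
  by_cases hi : i ∈ S
  · have := P.ae_law (θ i)
    rw [← P.coe_profile_of_mem S θ hi] at this
    filter_upwards [htend this] with v hv
    exact ⟨fun _ => hv, fun h => absurd hi h⟩
  · have : ∀ᵐ t ∂(P.profile S θ i : Measure ℝ), t = P.B := by
      rw [P.coe_profile_of_notMem S θ hi, ae_dirac_eq]; exact rfl
    filter_upwards [htend this] with v hv
    exact ⟨fun h => absurd h hi, fun _ => hv⟩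

/-- On the support of the profile, the virtual surplus `r` of the optimal auction dominates the
virtual value of every bidder, and the offer `B`. If all bidders are in `S`, nobody makes the offer
`B`, which is why `B = 0` is required then. -/
theorem exists_surplus_eq (hS : P.B = 0 ∨ S ≠ Finset.univ) {v : Fin n → ℝ}
    (hv : ∀ i, (i ∈ S → (v i ∈ Icc 0 P.B ∨ v i = P.c ∨ v i = P.h)) ∧ (i ∉ S → v i = P.B)) :
    ∃ r, P.B ≤ r ∧ (∀ i, P.virtAt S θ i (v i) ≤ r) ∧
      ∑ i, P.virtAt S θ i (v i) * (P.optimalAuction S θ).mechanism.alloc v i = r := by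
  have hBc := P.B_lt
  have hch := P.c_lt
  have ht := P.critVirtual_true
  have hf := P.critVirtual_false
  have htc := P.critVirtual_le true
  set Q := P.optimalAuction S θ with hQ
  -- the virtual value that a score stands for
  let V : ℕ → ℝ := fun σ => if σ ≤ 1 then P.B else if σ = 2 then P.critVirtual true else P.h
  have hV : ∀ i, P.virtAt S θ i (v i) ≤ V (Q.score i (v i)) ∧
      (0 < Q.score i (v i) → P.virtAt S θ i (v i) = V (Q.score i (v i))) ∧
      Q.score i (v i) ≤ 3 := by
    intro i
    by_cases hi : i ∈ S
    · rcases (hv i).1 hi with h | h | h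
      · have h1 : v i < P.c := h.2.trans_lt hBc
        simp [PriorityAuction.score, hQ, optimalAuction, hi, h1, V, virtAt, P.virt_low _ h1]
      · rw [h]
        cases hθ : θ i <;>
        simp [PriorityAuction.score, hQ, optimalAuction, hi, hch, V, virtAt, virt_c, hθ, hf.le]
      · rw [h]
        simp [PriorityAuction.score, hQ, optimalAuction, hi, hch.not_gt, V, virtAt, virt_h]
    · rw [(hv i).2 hi]
      simp [PriorityAuction.score, hQ, optimalAuction, hi, V, virtAt]
  have hVmono : ∀ σ τ, σ ≤ τ → τ ≤ 3 → V σ ≤ V τ := by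
    intro σ τ h1 h2
    simp only [V]
    split_ifs <;> first | omega | linarith
  by_cases hpos : ∃ j, 0 < Q.score j (v j)
  · obtain ⟨j, hj⟩ := hpos
    obtain ⟨k, hk, hmax⟩ := Q.exists_wins hj
    refine ⟨V (Q.score k (v k)), ?_, fun i => ?_, ?_⟩
    · exact (show V 0 = P.B by simp [V]) ▸ hVmono 0 _ (Nat.zero_le _) (hV k).2.2
    · exact (hV i).1.trans (hVmono _ _ (hmax i) (hV k).2.2)
    · rw [Finset.sum_eq_single k]
      · rw [PriorityAuction.mechanism_alloc, PriorityAuction.winInd, if_pos hk,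
          (hV k).2.1 hk.1, mul_one]
      · intro i _ hik
        have : ¬ Q.Wins v i (Q.score i (v i)) := fun hw =>
          lt_asymm (hk.2 i hik) (hw.2 k (Ne.symm hik))
        rw [PriorityAuction.mechanism_alloc, PriorityAuction.winInd, if_neg this, mul_zero]
      · simp
  · push Not at hpos
    have h0 : ∀ i, Q.score i (v i) = 0 := fun i => Nat.le_zero.1 (hpos i)
    have hSu : S = Finset.univ := by
      refine Finset.eq_univ_iff_forall.2 fun i => ?_
      by_contra hi
      have := h0 i
      rw [(hv i).2 hi] at this
      simp [PriorityAuction.score, hQ, optimalAuction, hi] at this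
    have hB0 : P.B = 0 := hS.resolve_right (by simpa using hSu)
    refine ⟨P.B, le_rfl, fun i => ?_, ?_⟩
    · have := (hV i).1
      rw [h0 i] at this
      simpa [V] using this
    · rw [hB0]
      exact Finset.sum_eq_zero fun i _ => by
        rw [PriorityAuction.mechanism_alloc, h0 i, PriorityAuction.winInd_zero, mul_zero]

/-- The value `h` occurs with conditional probability at most `ratio + δ`, and the value `c`
contributes at most `(h - B) δ` by `mul_critVirtual_sub`. -/
theorem integral_pos_part_virt_le (b : Bool) :
    ∫ t, max (P.virt b t - P.B) 0 ∂(P.law b : Measure ℝ)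
      ≤ P.q * ((P.h - P.B) * (P.ratio + 2 * P.δ)) := by
  have hBh : 0 < P.h - P.B := by linarith [P.B_lt, P.c_lt]
  have hi : Integrable (fun t => max (P.virt b t - P.B) 0) (P.law b : Measure ℝ) := by
    refine integrable_of_abs_le (((P.measurable_virt b).sub_const _).max measurable_const)
      (|P.h| + |P.critVirtual b| + |P.B| + |P.B|) fun t => ?_
    have h1 := P.abs_virt_le b t
    rw [abs_of_nonneg (le_max_right _ _)]
    refine max_le ?_ (by positivity)
    linarith [le_abs_self (P.virt b t), neg_abs_le P.B]
  rw [(P.integral_law hi).2]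
  have h0 : ∫ t, max (P.virt b t - P.B) 0 ∂((1 - P.q).toNNReal • (P.base : Measure ℝ)) = 0 := by
    refine integral_eq_zero_of_ae ?_
    filter_upwards [P.ae_smul_base] with t ht
    simp [P.virt_low b (ht.2.trans_lt P.B_lt)]
  rw [h0, zero_add, virt_h, virt_c, max_eq_left hBh.le, mul_assoc, mul_assoc, ← mul_add]
  refine mul_le_mul_of_nonneg_left ?_ P.q_pos.le
  have h1 : (1 - P.top b) * max (P.critVirtual b - P.B) 0 ≤ (P.h - P.B) * P.δ := by
    have h2 := P.mul_critVirtual_sub b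
    have h3 := P.top_lt_one b
    have h4 : 0 ≤ (P.h - P.B) * P.δ := mul_nonneg hBh.le P.δ_pos.le
    rcases max_cases (P.critVirtual b - P.B) 0 with ⟨h, -⟩ | ⟨h, -⟩ <;> rw [h]
    · rw [h2]; cases b <;> simp; linarith
    · simpa using h4
  have h5 := P.top_le b
  nlinarith [mul_le_mul_of_nonneg_right h5 hBh.le]

theorem optimalRev_le :
    P.optimalRev S θ ≤ P.B + S.card * (P.q * ((P.h - P.B) * (P.ratio + 2 * P.δ))) := by
  rw [optimalRev_eq]
  have hf : ∀ i, Measurable fun t => max (P.virt (θ i) t - P.B) 0 := fun i =>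
    ((P.measurable_virt (θ i)).sub_const _).max measurable_const
  have hint : ∀ i ∈ S, Integrable (fun v : Fin n → ℝ => max (P.virt (θ i) (v i) - P.B) 0)
      (prior (P.profile S θ)) := fun i _ => by
    refine integrable_of_abs_le ((hf i).comp (measurable_pi_apply i))
      (|P.h| + |P.critVirtual (θ i)| + |P.B| + |P.B|) fun v => ?_
    have h1 := P.abs_virt_le (θ i) (v i)
    rw [abs_of_nonneg (le_max_right _ _)]
    refine max_le ?_ (by positivity)
    linarith [le_abs_self (P.virt (θ i) (v i)), neg_abs_le P.B]
  have hle : P.virtualSurplus S θ (P.optimalAuction S θ).mechanism ≤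
      ∫ v, (P.B + ∑ i ∈ S, max (P.virt (θ i) (v i) - P.B) 0) ∂(prior (P.profile S θ)) := by
    refine integral_mono (integrable_finsetSum _ fun i _ => P.integrable_virtAt_mul_alloc S θ _ i)
      ((integrable_const _).add (integrable_finsetSum _ hint)) fun v => ?_
    set M := (P.optimalAuction S θ).mechanism
    have h1 : ∀ i, P.virtAt S θ i (v i) * M.alloc v i ≤ P.B * M.alloc v i +
        if i ∈ S then max (P.virt (θ i) (v i) - P.B) 0 else 0 := by
      intro i
      have h2 := M.alloc_nonneg v i
      have h3 := M.alloc_le_one v i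
      by_cases hi : i ∈ S
      · simp only [virtAt, hi, if_true]
        have h4 := le_max_left (P.virt (θ i) (v i) - P.B) 0
        have h5 := le_max_right (P.virt (θ i) (v i) - P.B) 0
        nlinarith
      · simp [virtAt, hi]
    refine (Finset.sum_le_sum fun i _ => h1 i).trans ?_
    rw [Finset.sum_add_distrib, ← Finset.mul_sum, Finset.sum_ite_mem, Finset.univ_inter]
    have := mul_le_mul_of_nonneg_left (M.sum_alloc_le_one v) P.B_nonneg
    simp only [mul_one] at this
    exact add_le_add_left this _
  refine hle.trans ?_
  rw [integral_add (integrable_const _) (integrable_finsetSum _ hint), integral_finsetSum _ hint]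
  simp only [integral_const, probReal_univ, smul_eq_mul, one_mul]
  have : ∑ i ∈ S, ∫ v, max (P.virt (θ i) (v i) - P.B) 0 ∂(prior (P.profile S θ))
      ≤ ∑ _i ∈ S, P.q * ((P.h - P.B) * (P.ratio + 2 * P.δ)) := by
    refine Finset.sum_le_sum fun i hi => ?_
    have h := integral_comp_eval (μ := fun j => (P.profile S θ j : Measure ℝ)) (i := i)
      (f := fun t => max (P.virt (θ i) t - P.B) 0) (hf i).aestronglyMeasurable
    unfold prior
    rw [h, P.coe_profile_of_mem S θ hi]
    exact P.integral_pos_part_virt_le (θ i)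
  rw [Finset.sum_const, nsmul_eq_mul] at this
  linarith

end HardPair

/-! ### The loss of a mechanism that treats critical bidders wrongly -/

/-- The loss for allocating `x` to a critical bidder who should get the item if `b` is `true`, and
should not get it otherwise. -/
def allocErr (b : Bool) (x : ℝ) : ℝ := if b then 1 - x else x

theorem allocErr_nonneg (b : Bool) {x : ℝ} (h0 : 0 ≤ x) (h1 : x ≤ 1) : 0 ≤ allocErr b x := by
  cases b <;> simp [allocErr] <;> linarith

theorem allocErr_le_one (b : Bool) {x : ℝ} (h0 : 0 ≤ x) (h1 : x ≤ 1) : allocErr b x ≤ 1 := by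
  cases b <;> simp [allocErr] <;> linarith

namespace HardPair

variable (P : HardPair) {n : ℕ} (S : Finset (Fin n)) (θ : Fin n → Bool)

/-- The value distribution of bidder `j`, given that bidder `i` is critical and all other bidders
have trivial values. It does not depend on `θ`. -/
noncomputable def critMarginal (i j : Fin n) : Measure ℝ :=
  if j = i then Measure.dirac P.c else if j ∈ S then (P.base : Measure ℝ) else Measure.dirac P.B

instance (i j : Fin n) : IsProbabilityMeasure (P.critMarginal S i j) := by
  unfold critMarginal; split_ifs <;> infer_instance

/-- The expected allocation of bidder `i`, given that `i` is critical and all other bidders have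
trivial values. -/
noncomputable def critAlloc (M : Mechanism n) (i : Fin n) : ℝ :=
  ∫ w, M.alloc w i ∂(Measure.pi (P.critMarginal S i))

theorem critAlloc_nonneg (M : Mechanism n) (i : Fin n) : 0 ≤ P.critAlloc S M i :=
  integral_nonneg fun _ => M.alloc_nonneg _ _

theorem critAlloc_le_one (M : Mechanism n) (i : Fin n) : P.critAlloc S M i ≤ 1 := by
  refine (integral_mono (integrable_alloc M i) (integrable_const 1)
    fun w => M.alloc_le_one w i).trans ?_
  simp

/-- The event that bidder `i` is critical and all other bidders have trivial values. -/
def critEvent (i : Fin n) : Set (Fin n → ℝ) :=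
  univ.pi fun j => if j = i then {P.c} else Iio P.c

theorem measurableSet_critEvent (i : Fin n) : MeasurableSet (P.critEvent i) :=
  MeasurableSet.univ_pi fun j => by
    split_ifs; exacts [measurableSet_singleton _, measurableSet_Iio]

theorem mem_critEvent {i : Fin n} {v : Fin n → ℝ} :
    v ∈ P.critEvent i ↔ v i = P.c ∧ ∀ j, j ≠ i → v j < P.c := by
  simp only [critEvent, mem_univ_pi]
  constructor
  · intro h
    refine ⟨by simpa using h i, fun j hj => by simpa [hj] using h j⟩
  · rintro ⟨h1, h2⟩ j
    by_cases hj : j = i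
    · subst hj; simpa using h1
    · simpa [hj] using h2 j hj

theorem notMem_critEvent_of_ne {i j : Fin n} (hij : j ≠ i) {v : Fin n → ℝ}
    (h : v ∈ P.critEvent i) : v ∉ P.critEvent j := fun h' =>
  ((P.mem_critEvent.1 h).2 j hij).ne (P.mem_critEvent.1 h').1

theorem law_restrict_singleton (b : Bool) : (P.law b : Measure ℝ).restrict {P.c}
    = (P.q * (1 - P.top b)).toNNReal • Measure.dirac P.c := by
  classical
  have hb : (P.base : Measure ℝ).restrict {P.c} = 0 := by
    rw [Measure.restrict_eq_zero]
    refine measure_mono_null (t := (Icc 0 P.B)ᶜ) ?_ P.ae_base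
    rintro t rfl ht
    exact absurd ht.2 (not_le.2 P.B_lt)
  rw [coe_law, Measure.restrict_add, Measure.restrict_add]
  rw [Measure.restrict_smul, Measure.restrict_smul, Measure.restrict_smul, hb,
    restrict_dirac' (measurableSet_singleton _), restrict_dirac' (measurableSet_singleton _)]
  simp [P.c_lt.ne']

theorem law_restrict_Iio (b : Bool) : (P.law b : Measure ℝ).restrict (Iio P.c)
    = (1 - P.q).toNNReal • (P.base : Measure ℝ) := by
  classical
  have hb : (P.base : Measure ℝ).restrict (Iio P.c) = P.base := by
    refine Measure.restrict_eq_self_of_ae_mem ?_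
    filter_upwards [P.ae_base] with t ht
    exact ht.2.trans_lt P.B_lt
  rw [coe_law, Measure.restrict_add, Measure.restrict_add]
  rw [Measure.restrict_smul, Measure.restrict_smul, Measure.restrict_smul, hb,
    restrict_dirac' measurableSet_Iio, restrict_dirac' measurableSet_Iio]
  simp [P.c_lt.not_gt]

theorem prior_restrict_critEvent {i : Fin n} (hi : i ∈ S) :
    (prior (P.profile S θ)).restrict (P.critEvent i)
      = ((P.q * (1 - P.top (θ i))).toNNReal * (1 - P.q).toNNReal ^ (S.card - 1)) •
        Measure.pi (P.critMarginal S i) := by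
  classical
  let κ : Fin n → NNReal := fun j => if j = i then (P.q * (1 - P.top (θ i))).toNNReal
    else if j ∈ S then (1 - P.q).toNNReal else 1
  have hκ : ∏ j, κ j
      = (P.q * (1 - P.top (θ i))).toNNReal * (1 - P.q).toNNReal ^ (S.card - 1) := by
    rw [← Finset.mul_prod_erase _ _ (Finset.mem_univ i)]
    congr 1
    · simp [κ]
    · have h1 : ∀ j ∈ Finset.univ.erase i,
          κ j = if j ∈ S.erase i then (1 - P.q).toNNReal else 1 := by
        intro j hj
        have := Finset.ne_of_mem_erase hj
        simp [κ, this]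
      rw [Finset.prod_congr rfl h1, Finset.prod_ite_mem, Finset.prod_const,
        Finset.inter_eq_right.2 (Finset.erase_subset_erase _ (Finset.subset_univ S)),
        Finset.card_erase_of_mem hi]
  unfold prior critEvent
  rw [Measure.restrict_pi_pi, ← hκ, ← pi_smul_measure]
  congr 1
  funext j
  by_cases hj : j = i
  · subst hj
    rw [P.coe_profile_of_mem S θ hi]
    simp only [κ, critMarginal, if_true, law_restrict_singleton]
  · by_cases hjS : j ∈ S
    · rw [P.coe_profile_of_mem S θ hjS]
      simp [κ, critMarginal, law_restrict_Iio, hj, hjS]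
    · rw [P.coe_profile_of_notMem S θ hjS]
      simp [κ, critMarginal, hj, hjS, restrict_dirac' measurableSet_Iio, P.B_lt]

/-- The distance of the virtual value of `c` to the offer `B`. -/
noncomputable def gap (b : Bool) : ℝ :=
  if b then P.critVirtual b - P.B else P.B - P.critVirtual b

theorem mul_gap (b : Bool) : (1 - P.top b) * P.gap b = (P.h - P.B) * P.δ := by
  have := P.mul_critVirtual_sub b
  cases b <;> simp only [gap] <;> simp at this ⊢ <;> linarith

theorem gap_nonneg (b : Bool) : 0 ≤ P.gap b := by
  cases b <;> simp only [gap]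
  · simpa using P.critVirtual_false.le
  · simpa using P.critVirtual_true.le

/-- Pointwise comparison with the optimal auction, whose virtual surplus is maximal. The critical
events are disjoint, so that at most one summand on the left is nonzero. -/
theorem sum_indicator_le_surplus_sub (hS : P.B = 0 ∨ S ≠ Finset.univ) (M : Mechanism n)
    {v : Fin n → ℝ}
    (hv : ∀ i, (i ∈ S → (v i ∈ Icc 0 P.B ∨ v i = P.c ∨ v i = P.h)) ∧ (i ∉ S → v i = P.B)) :
    ∑ i ∈ S, (P.critEvent i).indicator
        (fun v => P.gap (θ i) * allocErr (θ i) (M.alloc v i)) v ≤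
      ∑ i, P.virtAt S θ i (v i) * (P.optimalAuction S θ).mechanism.alloc v i -
        ∑ i, P.virtAt S θ i (v i) * M.alloc v i := by
  obtain ⟨r, hBr, hr, hsum⟩ := P.exists_surplus_eq S θ hS hv
  rw [hsum]
  have hr0 : 0 ≤ r := P.B_nonneg.trans hBr
  by_cases h : ∃ i ∈ S, v ∈ P.critEvent i
  · obtain ⟨i, hi, hvi⟩ := h
    rw [Finset.sum_eq_single_of_mem i hi fun j _ hj =>
      indicator_of_notMem (P.notMem_critEvent_of_ne hj hvi) _, indicator_of_mem hvi]
    have hvirt : P.virtAt S θ i (v i) = P.critVirtual (θ i) := by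
      simp [virtAt, hi, (P.mem_critEvent.1 hvi).1, virt_c]
    have hother : ∀ j ∈ Finset.univ.erase i,
        P.virtAt S θ j (v j) * M.alloc v j = P.B * M.alloc v j := fun j hj => by
      have := (P.mem_critEvent.1 hvi).2 j (Finset.ne_of_mem_erase hj)
      unfold virtAt
      split_ifs
      · rw [P.virt_low _ this]
      · rfl
    rw [← Finset.add_sum_erase _ _ (Finset.mem_univ i), Finset.sum_congr rfl hother,
      ← Finset.mul_sum, hvirt]
    have h1 := M.sum_alloc_le_one v
    rw [← Finset.add_sum_erase _ _ (Finset.mem_univ i)] at h1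
    have h2 := mul_le_mul_of_nonneg_left h1 P.B_nonneg
    have h3 := hr i
    rw [hvirt] at h3
    generalize ∑ j ∈ Finset.univ.erase i, M.alloc v j = T at h2 ⊢
    cases hb : θ i <;> rw [hb] at h3 <;> simp only [gap, allocErr] <;> simp <;> nlinarith
  · push Not at h
    rw [Finset.sum_eq_zero fun i hi => indicator_of_notMem (h i hi) _, sub_nonneg]
    calc ∑ i, P.virtAt S θ i (v i) * M.alloc v i ≤ ∑ i, r * M.alloc v i :=
          Finset.sum_le_sum fun i _ => mul_le_mul_of_nonneg_right (hr i) (M.alloc_nonneg v i)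
      _ = r * ∑ i, M.alloc v i := by rw [Finset.mul_sum]
      _ ≤ r := mul_le_of_le_one_right hr0 (M.sum_alloc_le_one v)

/-- Each critical bidder treated wrongly costs a fixed amount of revenue. -/
theorem sum_allocErr_le_loss (hS : P.B = 0 ∨ S ≠ Finset.univ) {M : Mechanism n}
    (hM : IsBIC M (P.profile S θ)) :
    P.q * ((P.h - P.B) * P.δ) * (1 - P.q) ^ (S.card - 1) *
        ∑ i ∈ S, allocErr (θ i) (P.critAlloc S M i)
      ≤ P.optimalRev S θ - Rev M (P.profile S θ) := by
  have hq1 := P.q_le_one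
  have hmeas : ∀ i, Measurable fun v => P.gap (θ i) * allocErr (θ i) (M.alloc v i) := fun i => by
    have := M.measurable_alloc i
    cases h : θ i <;> simp only [allocErr] <;> simp <;> fun_prop
  have hint : ∀ i (μ : Measure (Fin n → ℝ)) [IsFiniteMeasure μ],
      Integrable (fun v => P.gap (θ i) * allocErr (θ i) (M.alloc v i)) μ := fun i μ _ =>
    integrable_of_abs_le (hmeas i) (P.gap (θ i)) fun v => by
      have h0 := M.alloc_nonneg v i
      have h1 := M.alloc_le_one v i
      rw [abs_of_nonneg (mul_nonneg (P.gap_nonneg _) (allocErr_nonneg _ h0 h1))]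
      exact mul_le_of_le_one_right (P.gap_nonneg _) (allocErr_le_one _ h0 h1)
  have hval : ∀ i ∈ S, ∫ v, (P.critEvent i).indicator
      (fun v => P.gap (θ i) * allocErr (θ i) (M.alloc v i)) v ∂(prior (P.profile S θ))
      = P.q * ((P.h - P.B) * P.δ) * (1 - P.q) ^ (S.card - 1) *
        allocErr (θ i) (P.critAlloc S M i) := fun i hi => by
    have herr : ∫ v, allocErr (θ i) (M.alloc v i) ∂(Measure.pi (P.critMarginal S i))
        = allocErr (θ i) (P.critAlloc S M i) := by
      cases h : θ i <;> simp only [allocErr, critAlloc] <;> simp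
      rw [integral_sub (integrable_const _) (integrable_alloc M i)]
      simp
    rw [integral_indicator (P.measurableSet_critEvent i), P.prior_restrict_critEvent S θ hi,
      integral_smul_nnreal_measure, integral_const_mul, herr, ← P.mul_gap (θ i),
      NNReal.smul_def, smul_eq_mul]
    push_cast
    rw [Real.coe_toNNReal _ (mul_nonneg P.q_pos.le (by linarith [P.top_lt_one (θ i)])),
      Real.coe_toNNReal _ (by linarith)]
    ring
  rw [Finset.mul_sum, ← Finset.sum_congr rfl hval,
    ← integral_finsetSum _ fun i _ => (hint i _).indicator (P.measurableSet_critEvent i)]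
  have hrev := P.rev_le_virtualSurplus S θ hM
  rw [optimalRev_eq]
  refine le_trans ?_ (sub_le_sub_left hrev _)
  unfold virtualSurplus
  rw [← integral_sub (integrable_finsetSum _ fun i _ => P.integrable_virtAt_mul_alloc S θ _ i)
    (integrable_finsetSum _ fun i _ => P.integrable_virtAt_mul_alloc S θ _ i)]
  refine integral_mono_ae
    (integrable_finsetSum _ fun i _ => (hint i _).indicator (P.measurableSet_critEvent i))
    ((integrable_finsetSum _ fun i _ => P.integrable_virtAt_mul_alloc S θ _ i).sub
      (integrable_finsetSum _ fun i _ => P.integrable_virtAt_mul_alloc S θ _ i)) ?_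
  filter_upwards [P.ae_profile S θ] with v hv
  exact P.sum_indicator_le_surplus_sub S θ hS M hv

end HardPair

/-! ### Indistinguishability of the two hard distributions -/

namespace HardPair

variable (P : HardPair)

/-- The likelihood ratio of `law true` to `law false`. -/
noncomputable def likelihood (t : ℝ) : ℝ :=
  if t = P.h then P.top true / P.top false
  else if t = P.c then (1 - P.top true) / (1 - P.top false) else 1

theorem measurable_likelihood : Measurable P.likelihood :=
  Measurable.ite (measurableSet_singleton _) measurable_const
    (Measurable.ite (measurableSet_singleton _) measurable_const measurable_const)

theorem likelihood_nonneg (t : ℝ) : 0 ≤ P.likelihood t := by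
  have := P.top_pos true; have := P.top_pos false
  have := P.top_lt_one true; have := P.top_lt_one false
  unfold likelihood
  split_ifs
  · positivity
  · exact div_nonneg (by linarith) (by linarith)
  · norm_num

theorem likelihood_le (t : ℝ) :
    P.likelihood t ≤ P.top true / P.top false + (1 - P.top true) / (1 - P.top false) + 1 := by
  have := P.top_pos true; have := P.top_pos false
  have := P.top_lt_one true; have := P.top_lt_one false
  have h1 : 0 ≤ P.top true / P.top false := by positivity
  have h2 : 0 ≤ (1 - P.top true) / (1 - P.top false) := div_nonneg (by linarith) (by linarith)
  unfold likelihood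
  split_ifs <;> linarith

theorem likelihood_low {t : ℝ} (ht : t ∈ Icc 0 P.B) : P.likelihood t = 1 := by
  have h1 : t < P.c := ht.2.trans_lt P.B_lt
  simp [likelihood, h1.ne, (h1.trans P.c_lt).ne]

theorem law_true_eq_withDensity : (P.law true : Measure ℝ)
    = (P.law false : Measure ℝ).withDensity fun t => ENNReal.ofReal (P.likelihood t) := by
  have h1 := P.top_pos true; have h2 := P.top_pos false
  have h3 := P.top_lt_one true; have h4 := P.top_lt_one false
  have hq := P.q_pos
  have hs : ∀ (κ : NNReal) (μ : Measure ℝ),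
      (κ • μ).withDensity (fun t => ENNReal.ofReal (P.likelihood t))
        = κ • μ.withDensity fun t => ENNReal.ofReal (P.likelihood t) := fun κ μ =>
    withDensity_smul_measure (κ : ENNReal) _
  have hb : (P.base : Measure ℝ).withDensity (fun t => ENNReal.ofReal (P.likelihood t))
      = P.base := by
    rw [withDensity_congr_ae (g := 1), withDensity_one]
    filter_upwards [P.ae_base] with t ht
    simp [P.likelihood_low ht]
  have hmul : ∀ x y : ℝ, 0 ≤ x → ∀ a : ℝ, x.toNNReal • (ENNReal.ofReal y • Measure.dirac a)
      = (x * y).toNNReal • Measure.dirac a := fun x y hx a => by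
    rw [Real.toNNReal_mul hx, mul_smul]; rfl
  rw [coe_law, coe_law, withDensity_add_measure, withDensity_add_measure, hs, hs, hs, hb,
    withDensity_dirac_real, withDensity_dirac_real,
    hmul _ _ (mul_nonneg hq.le (by linarith)), hmul _ _ (mul_nonneg hq.le h2.le)]
  congr 4
  · simp only [likelihood, P.c_lt.ne, if_true, if_false]
    field_simp [show 1 - P.top false ≠ 0 by linarith]
  · simp only [likelihood, if_true]
    field_simp

/-- The chi-square divergence between the two hard distributions. -/
noncomputable def chi : ℝ := 4 * P.q * P.δ ^ 2 / (P.top false * (1 - P.top false))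

theorem integral_likelihood_sq :
    ∫ t, P.likelihood t ^ 2 ∂(P.law false : Measure ℝ) = 1 + P.chi := by
  have h2 := P.top_pos false; have h4 := P.top_lt_one false
  have hdiff : P.top true = P.top false - 2 * P.δ := by simp [top]; ring
  have hi : Integrable (fun t => P.likelihood t ^ 2) (P.law false : Measure ℝ) :=
    integrable_of_abs_le (P.measurable_likelihood.pow_const 2)
      ((P.top true / P.top false + (1 - P.top true) / (1 - P.top false) + 1) ^ 2) fun t => by
      rw [abs_of_nonneg (sq_nonneg _)]
      exact pow_le_pow_left₀ (P.likelihood_nonneg t) (P.likelihood_le t) 2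
  have hb : ∫ t, P.likelihood t ^ 2 ∂((1 - P.q).toNNReal • (P.base : Measure ℝ)) = 1 - P.q := by
    rw [integral_congr_ae (g := fun _ => 1)]
    · rw [integral_smul_nnreal_measure]
      simp only [integral_const, probReal_univ, NNReal.smul_def, smul_eq_mul, mul_one]
      exact Real.coe_toNNReal _ (by linarith [P.q_le_one])
    · filter_upwards [P.ae_smul_base] with t ht
      simp [P.likelihood_low ht]
  rw [(P.integral_law hi).2, hb]
  simp only [likelihood, P.c_lt.ne, if_true, if_false, chi, hdiff]
  field_simp [show 1 - P.top false ≠ 0 by linarith]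
  ring

theorem profile_update {n : ℕ} (S : Finset (Fin n)) (θ : Fin n → Bool) {i j : Fin n} (hj : j ≠ i)
    (b b' : Bool) : P.profile S (Function.update θ i b) j
      = P.profile S (Function.update θ i b') j := by
  simp [profile, Function.update_of_ne hj]

end HardPair

/-! ### Assouad's argument -/

/-- Averaging over all sign vectors: if flipping one coordinate of `θ` leaves the sum of the two
errors at least `3/5`, some `θ` has an average error of at least `3/10`. -/
theorem exists_sum_ge {n : ℕ} (S : Finset (Fin n)) (T : (Fin n → Bool) → Fin n → ℝ)
    (hT : ∀ θ, ∀ i ∈ S, 3 / 5 ≤ T (Function.update θ i true) i + T (Function.update θ i false) i) :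
    ∃ θ, 3 / 10 * (S.card : ℝ) ≤ ∑ i ∈ S, T θ i := by
  have hone : ∀ i ∈ S, ∑ _θ : Fin n → Bool, (3 / 10 : ℝ) ≤ ∑ θ : Fin n → Bool, T θ i := by
    intro i hi
    let flip : (Fin n → Bool) → (Fin n → Bool) := fun θ => Function.update θ i (!θ i)
    have hflip : Function.Involutive flip := fun θ => by simp [flip]
    have h1 : ∑ θ, T (flip θ) i = ∑ θ, T θ i :=
      Equiv.sum_comp hflip.toPerm fun θ => T θ i
    have h2 : ∑ _θ : Fin n → Bool, (3 / 5 : ℝ) ≤ ∑ θ, (T θ i + T (flip θ) i) := by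
      refine Finset.sum_le_sum fun θ _ => ?_
      have h := hT θ i hi
      cases hb : θ i
      · have : Function.update θ i false = θ := by rw [← hb, Function.update_eq_self]
        simp only [flip, hb, Bool.not_false]
        rw [this] at h; linarith
      · have : Function.update θ i true = θ := by rw [← hb, Function.update_eq_self]
        simp only [flip, hb, Bool.not_true]
        rw [this] at h; linarith
    rw [Finset.sum_add_distrib, h1] at h2
    rw [Finset.sum_const, nsmul_eq_mul] at h2 ⊢
    linarith
  have hall := Finset.sum_le_sum hone
  rw [Finset.sum_comm, Finset.sum_comm (s := S)] at hall
  obtain ⟨θ, -, hθ⟩ := Finset.exists_le_of_sum_le Finset.univ_nonempty hall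
  refine ⟨θ, le_trans (le_of_eq ?_) hθ⟩
  rw [Finset.sum_const, nsmul_eq_mul, mul_comm]

namespace HardPair

variable (P : HardPair)

variable {n m : ℕ} (S : Finset (Fin n)) (A : LearningAlgorithm n m)

/-- The interim allocation of the returned mechanism to a critical bidder. -/
noncomputable def outputAlloc (i : Fin n) (z : (Fin m → Fin n → ℝ) × A.Seed) : ℝ :=
  P.critAlloc S (A.output z.1 z.2) i

theorem measurable_outputAlloc (i : Fin n) : Measurable (P.outputAlloc S A i) :=
  ((A.measurable_alloc i).stronglyMeasurable.integral_prod_right'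
    (ν := Measure.pi (P.critMarginal S i))).measurable

/-- If the number of samples is small compared to the inverse chi-square divergence, then the error
at some bidder is large for one of the two distributions of the bidder. -/
theorem three_fifths_le_err (θ : Fin n → Bool) {i : Fin n} (hi : i ∈ S)
    (hm : m * P.chi ≤ 1 / 10) :
    3 / 5 ≤ ∫ z, allocErr true (P.outputAlloc S A i z)
        ∂(A.law (P.profile S (Function.update θ i true))) +
      ∫ z, allocErr false (P.outputAlloc S A i z)
        ∂(A.law (P.profile S (Function.update θ i false))) := by
  have hX0 : ∀ z, 0 ≤ P.outputAlloc S A i z := fun z => P.critAlloc_nonneg S _ i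
  have hX1 : ∀ z, P.outputAlloc S A i z ≤ 1 := fun z => P.critAlloc_le_one S _ i
  have hXm := P.measurable_outputAlloc S A i
  have h := abs_integral_law_sub_le A (D := P.profile S (Function.update θ i false))
    (D' := P.profile S (Function.update θ i true)) (i := i)
    (fun j hj => P.profile_update S θ hj true false) P.measurable_likelihood P.likelihood_nonneg
    P.likelihood_le (by
      rw [P.coe_profile_of_mem S _ hi, P.coe_profile_of_mem S _ hi, Function.update_self,
        Function.update_self, law_true_eq_withDensity])
    (χ := P.chi) (by
      rw [P.coe_profile_of_mem S _ hi, Function.update_self, integral_likelihood_sq]) hm hXm hX0 hX1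
  have hi1 : Integrable (P.outputAlloc S A i)
      (A.law (P.profile S (Function.update θ i true))) :=
    integrable_of_abs_le hXm 1 fun z => by rw [abs_of_nonneg (hX0 z)]; exact hX1 z
  simp only [allocErr, if_true, Bool.false_eq_true, if_false]
  rw [integral_sub (integrable_const _) hi1]
  simp only [integral_const, probReal_univ, smul_eq_mul, mul_one]
  linarith [(abs_le.1 h).2]

/-- The sample complexity bound for a hard pair: an algorithm whose mechanisms lose at most `L`
needs a number of samples inverse to the chi-square divergence, if `L` is small compared to the
loss from treating a constant fraction of the critical bidders wrongly. -/
theorem one_tenth_lt_mul_chi (hS : P.B = 0 ∨ S ≠ Finset.univ) (hcard : 0 < S.card)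
    {F : Set (ProbabilityMeasure ℝ)} {good : Mechanism n → (Fin n → ProbabilityMeasure ℝ) → Prop}
    (hA : A.SucceedsOn F good) (hF : ∀ b, P.law b ∈ F)
    (hFB : S ≠ Finset.univ → diracProba P.B ∈ F) {L : ℝ}
    (hgood : ∀ θ M, good M (P.profile S θ) → IsBIC M (P.profile S θ) ∧
      P.optimalRev S θ - L ≤ Rev M (P.profile S θ))
    (hL : L ≤ 1 / 8 * S.card * (P.q * ((P.h - P.B) * P.δ)))
    (hpow : 1 / 2 ≤ (1 - P.q) ^ (S.card - 1)) : 1 / 10 < m * P.chi := by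
  by_contra! hm
  have hX0 : ∀ i z, 0 ≤ P.outputAlloc S A i z := fun i z => P.critAlloc_nonneg S _ i
  have hX1 : ∀ i z, P.outputAlloc S A i z ≤ 1 := fun i z => P.critAlloc_le_one S _ i
  obtain ⟨θ, hθ⟩ := exists_sum_ge S
    (fun θ i => ∫ z, allocErr (θ i) (P.outputAlloc S A i z) ∂(A.law (P.profile S θ)))
    fun θ i hi => by
      simpa only [Function.update_self] using P.three_fifths_le_err S A θ hi hm
  have hmem : ∀ i, P.profile S θ i ∈ F := fun i => by
    unfold profile
    split_ifs with hi
    · exact hF _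
    · exact hFB fun h => hi (h ▸ Finset.mem_univ i)
  obtain ⟨E, hE, hPE, hEgood⟩ := hA (P.profile S θ) hmem
  have hk : (0 : ℝ) < S.card := by exact_mod_cast hcard
  have hw : 0 < P.q * ((P.h - P.B) * P.δ) :=
    mul_pos P.q_pos (mul_pos (by linarith [P.B_lt, P.c_lt]) P.δ_pos)
  -- a good mechanism has a total error of at most a quarter of the number of bidders in `S`, and
  -- the failure probability adds at most one percent, less than the `3/10` at the chosen `θ`
  have hsucc : ∀ z ∈ E, ∑ i ∈ S, allocErr (θ i) (P.outputAlloc S A i z) ≤ S.card / 4 := by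
    intro z hz
    obtain ⟨hbic, hrev⟩ := hgood θ _ (hEgood z hz)
    have h1 := P.sum_allocErr_le_loss S θ hS hbic
    have h0 : 0 ≤ ∑ i ∈ S, allocErr (θ i) (P.critAlloc S (A.output z.1 z.2) i) :=
      Finset.sum_nonneg fun i _ => allocErr_nonneg _ (hX0 i z) (hX1 i z)
    change ∑ i ∈ S, allocErr (θ i) (P.critAlloc S (A.output z.1 z.2) i) ≤ S.card / 4
    set s := ∑ i ∈ S, allocErr (θ i) (P.critAlloc S (A.output z.1 z.2) i)
    set w := P.q * ((P.h - P.B) * P.δ)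
    have h2 : w * (1 / 2) * s ≤ w * (1 - P.q) ^ (S.card - 1) * s := by gcongr
    have h3 : w * s ≤ w * (S.card / 4) := by linarith
    exact le_of_mul_le_mul_left h3 hw
  have hpt : ∀ z, ∑ i ∈ S, allocErr (θ i) (P.outputAlloc S A i z)
      ≤ S.card / 4 + S.card * Eᶜ.indicator (fun _ => (1 : ℝ)) z := fun z => by
    by_cases hz : z ∈ E
    · simpa [hz] using hsucc z hz
    · have : ∑ i ∈ S, allocErr (θ i) (P.outputAlloc S A i z) ≤ ∑ _i ∈ S, (1 : ℝ) :=
        Finset.sum_le_sum fun i _ => allocErr_le_one _ (hX0 i z) (hX1 i z)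
      rw [Finset.sum_const, nsmul_eq_mul, mul_one] at this
      simp only [mem_compl_iff, hz, not_false_eq_true, indicator_of_mem]
      linarith
  have hint : ∀ i, Integrable (fun z => allocErr (θ i) (P.outputAlloc S A i z))
      (A.law (P.profile S θ)) := fun i => by
    have hXm := P.measurable_outputAlloc S A i
    refine integrable_of_abs_le ?_ 1 fun z => ?_
    · cases θ i <;> simp only [allocErr] <;> simp <;> fun_prop
    · rw [abs_of_nonneg (allocErr_nonneg _ (hX0 i z) (hX1 i z))]
      exact allocErr_le_one _ (hX0 i z) (hX1 i z)
  have hind : Integrable (Eᶜ.indicator fun _ => (1 : ℝ)) (A.law (P.profile S θ)) :=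
    (integrable_const 1).indicator hE.compl
  have hle := integral_mono (integrable_finsetSum S fun i _ => hint i)
    ((integrable_const ((S.card : ℝ) / 4)).add (hind.const_mul (S.card : ℝ))) hpt
  have hfail : (A.law (P.profile S θ)).real Eᶜ ≤ 1 / 100 := by
    rw [probReal_compl_eq_one_sub hE]
    have : (0.99 : ℝ) ≤ (A.law (P.profile S θ)).real E :=
      (ENNReal.ofReal_le_iff_le_toReal (measure_ne_top _ _)).1 hPE
    linarith
  simp only [Pi.add_apply] at hle
  rw [integral_finsetSum _ fun i _ => hint i, integral_add (integrable_const _) (hind.const_mul _),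
    integral_const_mul, integral_indicator hE.compl] at hle
  simp only [integral_const, probReal_univ, smul_eq_mul, one_mul, mul_one,
    measureReal_restrict_apply_univ] at hle
  nlinarith

end HardPair

/-! ### Sample complexity bounds for approximately optimal mechanisms -/

namespace HardPair

variable (P : HardPair) {n m : ℕ} (S : Finset (Fin n)) (A : LearningAlgorithm n m)

theorem optimalRev_le_Opt (θ : Fin n → Bool) :
    ((P.optimalRev S θ : ℝ) : EReal) ≤ Opt (P.profile S θ) :=
  le_iSup₂_of_le _ ((P.optimalAuction S θ).isBIC_mechanism _) le_rfl

/-- `one_tenth_lt_mul_chi` for multiplicative approximations: by `optimalRev_le` the left side of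
`hL` bounds `ε` times the optimal revenue. The probability that all other bidders in `S` are trivial
is at least `1/2` by `hpow` and Bernoulli's inequality. -/
theorem one_tenth_lt_mul_chi_of_mul (hS : P.B = 0 ∨ S ≠ Finset.univ) (hcard : 0 < S.card)
    {F : Set (ProbabilityMeasure ℝ)} {ε : ℝ} (hε : 0 ≤ ε) (hε1 : ε ≤ 1)
    (hA : A.SucceedsOn F (IsMulApprox ε)) (hF : ∀ b, P.law b ∈ F)
    (hFB : S ≠ Finset.univ → diracProba P.B ∈ F)
    (hL : ε * (P.B + S.card * (P.q * ((P.h - P.B) * (P.ratio + 2 * P.δ))))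
      ≤ 1 / 8 * S.card * (P.q * ((P.h - P.B) * P.δ)))
    (hpow : (S.card - 1) * P.q ≤ 1 / 2) : 1 / 10 < m * P.chi := by
  refine P.one_tenth_lt_mul_chi S A hS hcard hA hF hFB (fun θ M hM => ⟨hM.1, ?_⟩) hL ?_
  · have h1 : ((1 - ε : ℝ) : EReal) * ((P.optimalRev S θ : ℝ) : EReal)
        ≤ ((Rev M (P.profile S θ) : ℝ) : EReal) :=
      (mul_le_mul_of_nonneg_left (P.optimalRev_le_Opt S θ)
        (by exact_mod_cast sub_nonneg.2 hε1)).trans hM.2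
    have h2 : (1 - ε) * P.optimalRev S θ ≤ Rev M (P.profile S θ) := by exact_mod_cast h1
    have h3 := mul_le_mul_of_nonneg_left (P.optimalRev_le S θ) hε
    linarith
  · have h := one_add_mul_le_pow (a := -P.q) (by linarith [P.q_le_one]) (S.card - 1)
    rw [Nat.cast_sub hcard, Nat.cast_one] at h
    rw [sub_eq_add_neg]
    linarith

theorem one_tenth_lt_mul_chi_of_add (hS : P.B = 0 ∨ S ≠ Finset.univ) (hcard : 0 < S.card)
    {F : Set (ProbabilityMeasure ℝ)} {ε : ℝ}
    (hA : A.SucceedsOn F (IsAddApprox ε)) (hF : ∀ b, P.law b ∈ F)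
    (hFB : S ≠ Finset.univ → diracProba P.B ∈ F)
    (hL : ε ≤ 1 / 8 * S.card * (P.q * ((P.h - P.B) * P.δ)))
    (hpow : (S.card - 1) * P.q ≤ 1 / 2) : 1 / 10 < m * P.chi := by
  refine P.one_tenth_lt_mul_chi S A hS hcard hA hF hFB (fun θ M hM => ⟨hM.1, ?_⟩) hL ?_
  · have h1 := (P.optimalRev_le_Opt S θ).trans hM.2
    have h2 : P.optimalRev S θ ≤ Rev M (P.profile S θ) + ε := by exact_mod_cast h1
    linarith
  · have h := one_add_mul_le_pow (a := -P.q) (by linarith [P.q_le_one]) (S.card - 1)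
    rw [Nat.cast_sub hcard, Nat.cast_one] at h
    rw [sub_eq_add_neg]
    linarith

theorem chi_le (h1 : 1 / 3 ≤ P.ratio + P.δ) (h2 : P.ratio + P.δ ≤ 2 / 3) :
    P.chi ≤ 20 * (P.q * P.δ ^ 2) := by
  have ht : P.top false = P.ratio + P.δ := by simp [top]
  have h3 : 1 / 5 ≤ P.top false * (1 - P.top false) := by rw [ht]; nlinarith
  unfold chi
  rw [div_le_iff₀ (by linarith)]
  have : 0 ≤ P.q * P.δ ^ 2 := mul_nonneg P.q_pos.le (sq_nonneg _)
  nlinarith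

theorem law_real (b : Bool) {s : Set ℝ} (hs : MeasurableSet s) :
    (P.law b : Measure ℝ).real s = (1 - P.q) * (P.base : Measure ℝ).real s +
      (P.q * (1 - P.top b) * s.indicator 1 P.c + P.q * P.top b * s.indicator 1 P.h) := by
  have hi : Integrable (s.indicator (1 : ℝ → ℝ)) (P.law b : Measure ℝ) :=
    (integrable_const 1).indicator hs
  have h := (P.integral_law hi).2
  rw [integral_indicator_one hs, integral_smul_nnreal_measure, integral_indicator_one hs,
    NNReal.smul_def, Real.coe_toNNReal _ (by linarith [P.q_le_one]), smul_eq_mul] at h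
  exact h

theorem law_mem_boundedDistributions {a b : ℝ} (ha : a ≤ P.c) (hb : P.h ≤ b)
    (hbase : P.q = 1 ∨ (P.base : Measure ℝ) (Icc a b) = 1) (θ : Bool) :
    P.law θ ∈ boundedDistributions a b := by
  have hc : P.c ∈ Icc a b := ⟨ha, P.c_lt.le.trans hb⟩
  have hh : P.h ∈ Icc a b := ⟨ha.trans P.c_lt.le, hb⟩
  have h := P.law_real θ (measurableSet_Icc (a := a) (b := b))
  simp only [hc, hh, indicator_of_mem, Pi.one_apply, mul_one] at h
  have h1 : (P.law θ : Measure ℝ).real (Icc a b) = 1 := by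
    rw [h]
    rcases hbase with hq | hbase
    · rw [hq]; ring
    · rw [measureReal_def, hbase]; simp; ring
  rwa [measureReal_def, ENNReal.toReal_eq_one_iff] at h1

end HardPair

theorem diracProba_mem_boundedDistributions {a b x : ℝ} (h : x ∈ Icc a b) :
    diracProba x ∈ boundedDistributions a b := by
  change Measure.dirac x (Icc a b) = 1
  rw [Measure.dirac_apply' _ measurableSet_Icc, indicator_of_mem h, Pi.one_apply]

theorem isPointMass_diracProba {x : ℝ} (h : 0 ≤ x) : IsPointMass (diracProba x) :=
  ⟨x, h, rfl⟩

theorem exists_finset_card_eq_pred {n : ℕ} (hn : 1 ≤ n) :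
    ∃ S : Finset (Fin n), S ≠ Finset.univ ∧ S.card = n - 1 :=
  ⟨Finset.univ.erase ⟨0, hn⟩, fun h => by
    simpa using Finset.eq_univ_iff_forall.1 h ⟨0, hn⟩, by simp⟩

/-! ### Distributions on `[1, H]` and on `[0, 1]` -/

/-- Values `1`, `(1 + H) / 2` and `H`, against an offer of `1`. As `q = 1 / (2 k H)`, the top values
of `k` bidders contribute only a constant to the revenue. -/
noncomputable def boundedHardPair (k H ε : ℝ) (hk : 1 ≤ k) (hH : 2 ≤ H) (hε : 0 < ε)
    (hε' : ε ≤ 1 / 640) : HardPair where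
  base := diracProba 1
  B := 1
  c := (1 + H) / 2
  h := H
  q := 1 / (2 * k * H)
  δ := 64 * ε
  B_nonneg := by norm_num
  B_lt := by linarith
  c_lt := by linarith
  q_pos := by positivity
  q_le_one := by rw [div_le_one (by positivity)]; nlinarith
  δ_pos := by positivity
  δ_lt := by rw [lt_div_iff₀ (by linarith)]; nlinarith
  lt_one := by
    rw [show ((1 + H) / 2 - 1) / (H - 1) = 1 / 2 by
      field_simp [show H - 1 ≠ 0 by linarith]; ring]
    linarith
  base_Icc := by simp [diracProba]

theorem bounded_lower_bound_of_two_le {n m : ℕ} {H ε : ℝ} (A : LearningAlgorithm n m) (hn : 2 ≤ n)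
    (hH : 2 ≤ H) (hε : 0 < ε) (hε' : ε ≤ 1 / 640)
    (hA : A.SucceedsOn (boundedDistributions 1 H) (IsMulApprox ε)) :
    1 / 1000000 * n * H / ε ^ 2 ≤ m := by
  obtain ⟨S, hS, hcard⟩ := exists_finset_card_eq_pred (n := n) (by omega)
  have hk : (S.card : ℝ) = n - 1 := by rw [hcard, Nat.cast_sub (by omega)]; simp
  have hn' : (2 : ℝ) ≤ n := by exact_mod_cast hn
  have hk1 : (1 : ℝ) ≤ S.card := by linarith
  set k : ℝ := (S.card : ℝ)
  let P := boundedHardPair k H ε hk1 hH hε hε'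
  have hH1 : H - 1 ≠ 0 := by linarith
  have hratio : P.ratio = 1 / 2 := by
    simp only [P, HardPair.ratio, boundedHardPair]; field_simp; ring
  have hkq : k * P.q = 1 / (2 * H) := by
    simp only [P, boundedHardPair]; field_simp
  have h := P.one_tenth_lt_mul_chi_of_mul S A (Or.inr hS) (by omega) hε.le (by linarith) hA
    (P.law_mem_boundedDistributions (by simp only [P, boundedHardPair]; linarith) le_rfl
      (Or.inr (by simp [P, boundedHardPair, diracProba, show (1 : ℝ) ≤ H by linarith])))
    (fun _ => diracProba_mem_boundedDistributions
      ⟨le_rfl, by simp only [P, boundedHardPair]; linarith⟩)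
    (by
      rw [hratio, ← mul_assoc (S.card : ℝ) P.q, mul_assoc (1 / 8 : ℝ),
        ← mul_assoc (S.card : ℝ) P.q, hkq]
      simp only [P, boundedHardPair]
      have h1 : 1 / (2 * H) * (H - 1) ≤ 1 / 2 := by
        rw [div_mul_eq_mul_div, div_le_iff₀ (by positivity)]; linarith
      have h2 : 1 / 4 ≤ 1 / (2 * H) * (H - 1) := by
        rw [div_mul_eq_mul_div, le_div_iff₀ (by positivity)]; linarith
      rw [← mul_assoc (1 / (2 * H)), ← mul_assoc (1 / (2 * H))]
      set x := 1 / (2 * H) * (H - 1)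
      have h3 : x * (1 / 2 + 2 * (64 * ε)) ≤ 1 / 2 := by nlinarith
      nlinarith)
    (by
      have : 1 / (2 * H) ≤ 1 / 2 := by
        rw [div_le_div_iff₀ (by positivity) (by norm_num)]; linarith
      nlinarith [P.q_pos])
  have hchi := P.chi_le (by rw [hratio]; linarith [P.δ_pos])
    (by rw [hratio]; simp only [P, boundedHardPair]; linarith)
  have hq : P.q ≤ 1 / (n * H) := by
    simp only [P, boundedHardPair]
    apply one_div_le_one_div_of_le (by positivity)
    gcongr; linarith
  have hδ : P.δ = 64 * ε := rfl
  have h2 : P.chi ≤ 20 * (1 / (n * H) * (64 * ε) ^ 2) := by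
    refine hchi.trans ?_
    rw [hδ]; gcongr
  have h3 : 1 / 10 < m * (20 * (1 / (n * H) * (64 * ε) ^ 2)) :=
    h.trans_le (mul_le_mul_of_nonneg_left h2 (Nat.cast_nonneg m))
  have hnH : 0 < n * H := by positivity
  rw [div_le_iff₀ (by positivity)]
  have h4 : m * (20 * (1 / (n * H) * (64 * ε) ^ 2)) * (n * H) = m * (81920 * ε ^ 2) := by
    field_simp; ring
  nlinarith [mul_lt_mul_of_pos_right h3 hnH]

/-- Values `1` and `H` of a single bidder. All values are nontrivial as `q = 1`, so `base` is
irrelevant. -/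
noncomputable def singleBidderHardPair (H ε : ℝ) (hH : 2 ≤ H) (hε : 0 < ε)
    (hε' : ε ≤ 1 / 640) : HardPair where
  base := diracProba 0
  B := 0
  c := 1
  h := H
  q := 1
  δ := 16 * ε / H
  B_nonneg := le_rfl
  B_lt := by norm_num
  c_lt := by linarith
  q_pos := by norm_num
  q_le_one := le_rfl
  δ_pos := by positivity
  δ_lt := by rw [sub_zero, sub_zero]; gcongr; linarith
  lt_one := by
    rw [sub_zero, sub_zero, ← add_div, div_lt_one (by positivity)]; linarith
  base_Icc := by simp [diracProba]

theorem bounded_lower_bound_one {m : ℕ} {H ε : ℝ} (A : LearningAlgorithm 1 m)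
    (hH : 2 ≤ H) (hε : 0 < ε) (hε' : ε ≤ 1 / 640)
    (hA : A.SucceedsOn (boundedDistributions 1 H) (IsMulApprox ε)) :
    1 / 1000000 * H / ε ^ 2 ≤ m := by
  let P := singleBidderHardPair H ε hH hε hε'
  have hratio : P.ratio = 1 / H := by simp [P, HardPair.ratio, singleBidderHardPair]
  have hδ : P.δ = 16 * ε / H := rfl
  have h := P.one_tenth_lt_mul_chi_of_mul Finset.univ A (Or.inl rfl) (by simp) hε.le (by linarith)
    hA (P.law_mem_boundedDistributions le_rfl le_rfl (Or.inl rfl)) (fun h => absurd rfl h)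
    (by
      rw [hratio]
      simp only [P, singleBidderHardPair, Finset.card_univ, Fintype.card_fin, Nat.cast_one]
      have e1 : (0 + 1 * (1 * ((H - 0) * (1 / H + 2 * (16 * ε / H))))) = 1 + 32 * ε := by
        field_simp; ring
      have e2 : 1 / 8 * 1 * (1 * ((H - 0) * (16 * ε / H))) = 2 * ε := by field_simp; ring
      rw [e1, e2]; nlinarith)
    (by simp)
  have ht : P.top false = (1 + 16 * ε) / H := by
    simp [HardPair.top, hratio, hδ]; ring
  have h1 : 1 / H ≤ P.top false := by rw [ht]; gcongr; linarith
  have h2 : 2 / 5 ≤ 1 - P.top false := by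
    have : P.top false ≤ (1 + 16 * ε) / 2 := by rw [ht]; gcongr
    linarith
  have hpos : 0 < 1 / H := by positivity
  have hchi : P.chi ≤ 2560 * ε ^ 2 / H := by
    unfold HardPair.chi
    rw [hδ, show P.q = 1 from rfl, div_le_iff₀ (by nlinarith)]
    have h3 : 1 / H * (2 / 5) ≤ P.top false * (1 - P.top false) :=
      mul_le_mul h1 h2 (by norm_num) (P.top_pos false).le
    calc 4 * 1 * (16 * ε / H) ^ 2 = 2560 * ε ^ 2 / H * (1 / H * (2 / 5)) := by field_simp; ring
      _ ≤ _ := by gcongr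
  have h3 : 1 / 10 < m * (2560 * ε ^ 2 / H) :=
    h.trans_le (mul_le_mul_of_nonneg_left hchi (Nat.cast_nonneg m))
  rw [← mul_div_assoc, lt_div_iff₀ (by positivity)] at h3
  rw [div_le_iff₀ (by positivity)]
  nlinarith

/-- Values `0`, `1/2` and `1`. -/
noncomputable def unitHardPair (k ε : ℝ) (hk : 1 ≤ k) (hε : 0 < ε) (hε' : ε ≤ 1 / 640) :
    HardPair where
  base := diracProba 0
  B := 0
  c := 1 / 2
  h := 1
  q := 1 / (2 * k)
  δ := 16 * ε
  B_nonneg := le_rfl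
  B_lt := by norm_num
  c_lt := by norm_num
  q_pos := by positivity
  q_le_one := by rw [div_le_one (by positivity)]; linarith
  δ_pos := by positivity
  δ_lt := by norm_num; linarith
  lt_one := by norm_num; linarith
  base_Icc := by simp [diracProba]

theorem unit_lower_bound {n m : ℕ} {ε : ℝ} (A : LearningAlgorithm n m) (hn : 1 ≤ n)
    (hε : 0 < ε) (hε' : ε ≤ 1 / 640)
    (hA : A.SucceedsOn (boundedDistributions 0 1) (IsAddApprox ε)) :
    1 / 100000 * n / ε ^ 2 ≤ m := by
  have hn' : (1 : ℝ) ≤ n := by exact_mod_cast hn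
  let P := unitHardPair n ε hn' hε hε'
  have hratio : P.ratio = 1 / 2 := by simp [P, HardPair.ratio, unitHardPair]
  have hδ : P.δ = 16 * ε := rfl
  have hq : P.q = 1 / (2 * n) := rfl
  have h := P.one_tenth_lt_mul_chi_of_add Finset.univ A (Or.inl rfl) (by simp; omega)
    hA (P.law_mem_boundedDistributions (by norm_num [P, unitHardPair]) le_rfl
      (Or.inr (by simp [P, unitHardPair, diracProba]))) (fun h => absurd rfl h)
    (by
      rw [hq, hδ]
      simp only [P, unitHardPair, Finset.card_univ, Fintype.card_fin]
      apply le_of_eq; field_simp; norm_num)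
    (by
      rw [hq, Finset.card_univ, Fintype.card_fin, mul_one_div, div_le_div_iff₀ (by positivity)
        (by norm_num)]
      linarith)
  have hchi := P.chi_le (by rw [hratio]; linarith [P.δ_pos]) (by rw [hratio, hδ]; linarith)
  have h3 : 1 / 10 < m * (20 * (P.q * P.δ ^ 2)) :=
    h.trans_le (mul_le_mul_of_nonneg_left hchi (Nat.cast_nonneg m))
  rw [hq, hδ, show m * (20 * (1 / (2 * (n : ℝ)) * (16 * ε) ^ 2)) = m * (2560 * ε ^ 2) / n by
    field_simp; ring, lt_div_iff₀ (by positivity)] at h3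
  rw [div_le_iff₀ (by positivity)]
  nlinarith

/-! ### Discrete hard pairs on consecutive integers -/

/-- The weights of the geometric distribution with ratio `1/2`, conditioned on values below `K`. -/
noncomputable def geomWeight (K j : ℕ) : ℝ := (1 / 2) ^ (j + 1) / (1 - (1 / 2) ^ K)

theorem half_pow_lt_one {K : ℕ} (hK : 0 < K) : (1 / 2 : ℝ) ^ K < 1 :=
  pow_lt_one₀ (by norm_num) (by norm_num) hK.ne'

theorem geomWeight_pos {K : ℕ} (hK : 0 < K) (j : ℕ) : 0 < geomWeight K j :=
  div_pos (by positivity) (sub_pos.2 (half_pow_lt_one hK))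

theorem sum_geomWeight {K : ℕ} (hK : 0 < K) : ∑ j ∈ Finset.range K, geomWeight K j = 1 := by
  have h : ∀ K : ℕ, ∑ j ∈ Finset.range K, (1 / 2 : ℝ) ^ (j + 1) = 1 - (1 / 2) ^ K := by
    intro K
    induction K with
    | zero => simp
    | succ K ih => rw [Finset.sum_range_succ, ih]; ring
  unfold geomWeight
  rw [← Finset.sum_div, h, div_self (sub_pos.2 (half_pow_lt_one hK)).ne']

theorem sum_geomWeight_gt {K i : ℕ} (hi : i < K) :
    ∑ j ∈ Finset.range K, geomWeight K j * (if i < j then 1 else 0)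
      = ((1 / 2) ^ (i + 1) - (1 / 2) ^ K) / (1 - (1 / 2) ^ K) := by
  have h : ∀ K : ℕ, i + 1 ≤ K →
      ∑ j ∈ Finset.range K, (1 / 2 : ℝ) ^ (j + 1) * (if i < j then 1 else 0)
        = (1 / 2) ^ (i + 1) - (1 / 2) ^ K := by
    intro K hK
    induction K, hK using Nat.le_induction with
    | base =>
      rw [sub_self]
      refine Finset.sum_eq_zero fun j hj => ?_
      rw [if_neg (by have := Finset.mem_range.1 hj; omega), mul_zero]
    | succ K hK ih =>
      rw [Finset.sum_range_succ, ih, if_pos (by omega)]; ring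
  rw [← h K hi, Finset.sum_div]
  refine Finset.sum_congr rfl fun j _ => ?_
  unfold geomWeight; ring

/-- The geometric distribution with ratio `1/2`, conditioned on values below `K`. -/
noncomputable def geomBase (K : ℕ) (hK : 0 < K) : ProbabilityMeasure ℝ :=
  ⟨∑ j ∈ Finset.range K, (geomWeight K j).toNNReal • Measure.dirac (j : ℝ), ⟨by
    rw [Measure.finsetSum_apply]
    simp only [Measure.smul_apply, measure_univ, ENNReal.smul_def, smul_eq_mul, mul_one]
    norm_cast
    rw [← Real.toNNReal_sum_of_nonneg fun j _ => (geomWeight_pos hK j).le, sum_geomWeight hK]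
    simp⟩⟩

theorem geomBase_real {K : ℕ} (hK : 0 < K) {s : Set ℝ} (hs : MeasurableSet s) :
    (geomBase K hK : Measure ℝ).real s
      = ∑ j ∈ Finset.range K, geomWeight K j * s.indicator 1 (j : ℝ) := by
  rw [← integral_indicator_one hs]
  change ∫ t, s.indicator 1 t
    ∂(∑ j ∈ Finset.range K, (geomWeight K j).toNNReal • Measure.dirac (j : ℝ)) = _
  have hi : ∀ j ∈ Finset.range K, Integrable (s.indicator (1 : ℝ → ℝ))
      ((geomWeight K j).toNNReal • Measure.dirac (j : ℝ)) := fun j _ =>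
    (integrable_const (1 : ℝ)).indicator hs
  rw [integral_finsetSum_measure hi]
  refine Finset.sum_congr rfl fun j _ => ?_
  rw [integral_smul_nnreal_measure, integral_dirac, NNReal.smul_def,
    Real.coe_toNNReal _ (geomWeight_pos hK j).le, smul_eq_mul]

theorem geomBase_apply_eq_one {K : ℕ} (hK : 0 < K) {s : Set ℝ} (hs : MeasurableSet s)
    (h : ∀ j < K, (j : ℝ) ∈ s) : (geomBase K hK : Measure ℝ) s = 1 := by
  have h1 : (geomBase K hK : Measure ℝ).real s = 1 := by
    rw [geomBase_real hK hs, ← sum_geomWeight hK]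
    exact Finset.sum_congr rfl fun j hj => by
      rw [indicator_of_mem (h j (Finset.mem_range.1 hj)), Pi.one_apply, mul_one]
  rwa [measureReal_def, ENNReal.toReal_eq_one_iff] at h1

/-- Values `0, …, K - 1` with geometric weights, critical value `K`, and top value `K + 1`. -/
noncomputable def geomHardPair (K : ℕ) (hK : 0 < K) (B q δ : ℝ) (hB : 0 ≤ B) (hKB : K - 1 ≤ B)
    (hBK : B < K) (hq : 0 < q) (hq1 : q ≤ 1) (hδ : 0 < δ) (hδ1 : δ < (K - B) / (K + 1 - B))
    (hδ2 : (K - B) / (K + 1 - B) + δ < 1) : HardPair where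
  base := geomBase K hK
  B := B
  c := K
  h := K + 1
  q := q
  δ := δ
  B_nonneg := hB
  B_lt := hBK
  c_lt := by linarith
  q_pos := hq
  q_le_one := hq1
  δ_pos := hδ
  δ_lt := hδ1
  lt_one := hδ2
  base_Icc := geomBase_apply_eq_one hK measurableSet_Icc fun j hj => ⟨by positivity, by
    have : (j : ℝ) + 1 ≤ K := by exact_mod_cast hj
    linarith⟩

section GeomHardPair

variable {K : ℕ} {hK : 0 < K} {P : HardPair}

theorem geom_mass_of_lt (hbase : P.base = geomBase K hK) (hc : P.c = K) (hh : P.h = K + 1)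
    (b : Bool) {j : ℕ} (hj : j < K) :
    mass (P.law b) j = (1 - P.q) * geomWeight K j := by
  unfold mass
  rw [P.law_real b (measurableSet_singleton _), hbase,
    geomBase_real hK (measurableSet_singleton _), hc, hh,
    Finset.sum_eq_single_of_mem j (Finset.mem_range.2 hj)]
  · have h1 : (K : ℝ) ≠ j := by exact_mod_cast hj.ne'
    have h2 : (K : ℝ) + 1 ≠ j := by exact_mod_cast (by omega : K + 1 ≠ j)
    simp [h1, h2]
  · intro i _ hij
    have : (i : ℝ) ≠ j := by exact_mod_cast hij
    simp [this]

theorem geom_mass_of_ge (hbase : P.base = geomBase K hK) (hc : P.c = K) (hh : P.h = K + 1)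
    (b : Bool) {j : ℕ} (hj : K ≤ j) :
    mass (P.law b) j = if j = K then P.q * (1 - P.top b) else
      if j = K + 1 then P.q * P.top b else 0 := by
  unfold mass
  rw [P.law_real b (measurableSet_singleton _), hbase,
    geomBase_real hK (measurableSet_singleton _), hc, hh, Finset.sum_eq_zero]
  · rcases eq_or_ne j K with rfl | h1
    · simp
    · have h1' : (K : ℝ) ≠ j := by exact_mod_cast h1.symm
      rcases eq_or_ne j (K + 1) with rfl | h2
      · simp
      · have h2' : (K : ℝ) + 1 ≠ j := by exact_mod_cast h2.symm
        simp [h1, h2, h1', h2']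
  · intro i hi
    have : (i : ℝ) ≠ j := by
      have := Finset.mem_range.1 hi
      exact_mod_cast (by omega : i ≠ j)
    simp [this]

theorem geom_tail_of_lt (hbase : P.base = geomBase K hK) (hc : P.c = K) (hh : P.h = K + 1)
    (b : Bool) {j : ℕ} (hj : j < K) :
    (P.law b : Measure ℝ).real (Ioi (j : ℝ))
      = (1 - P.q) * (((1 / 2) ^ (j + 1) - (1 / 2) ^ K) / (1 - (1 / 2) ^ K)) + P.q := by
  rw [P.law_real b measurableSet_Ioi, hbase, geomBase_real hK measurableSet_Ioi, hc, hh,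
    ← sum_geomWeight_gt hj]
  have h1 : (K : ℝ) ∈ Ioi (j : ℝ) := by simpa using hj
  have h2 : (K : ℝ) + 1 ∈ Ioi (j : ℝ) := (mem_Ioi.1 h1).trans (lt_add_one _)
  rw [indicator_of_mem h1, indicator_of_mem h2]
  congr 1
  · congr 1
    refine Finset.sum_congr rfl fun i _ => ?_
    simp [indicator_apply]
  · simp only [Pi.one_apply]; ring

theorem geom_tail_critical (hbase : P.base = geomBase K hK) (hc : P.c = K) (hh : P.h = K + 1)
    (b : Bool) : (P.law b : Measure ℝ).real (Ioi (K : ℝ)) = P.q * P.top b := by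
  rw [P.law_real b measurableSet_Ioi, hbase, geomBase_real hK measurableSet_Ioi, hc, hh,
    Finset.sum_eq_zero]
  · simp
  · intro i hi
    have : ¬ K < i := by have := Finset.mem_range.1 hi; omega
    simp [this]

theorem geom_tail_top (hbase : P.base = geomBase K hK) (hc : P.c = K) (hh : P.h = K + 1)
    (b : Bool) : (P.law b : Measure ℝ).real (Ioi ((K : ℝ) + 1)) = 0 := by
  rw [P.law_real b measurableSet_Ioi, hbase, geomBase_real hK measurableSet_Ioi, hc, hh,
    Finset.sum_eq_zero]
  · simp
  · intro i hi
    have h : i < K + 1 := by have := Finset.mem_range.1 hi; omega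
    have : ¬ (K : ℝ) + 1 < i := by
      have : (i : ℝ) < K + 1 := by exact_mod_cast h
      linarith
    simp [this]

theorem geom_natSupport (hbase : P.base = geomBase K hK) (hc : P.c = K) (hh : P.h = K + 1)
    (hq : P.q < 1) (b : Bool) : natSupport (P.law b) = Iic (K + 1) := by
  have hq0 := P.q_pos
  have h1 := P.top_pos b
  have h2 := P.top_lt_one b
  ext j
  simp only [natSupport, mem_ofPred_eq, mem_Iic]
  rcases lt_or_ge j K with hj | hj
  · rw [geom_mass_of_lt hbase hc hh b hj]
    exact iff_of_true (mul_pos (by linarith) (geomWeight_pos hK j)) (by omega)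
  · rw [geom_mass_of_ge hbase hc hh b hj]
    split_ifs with h3 h4
    · exact iff_of_true (mul_pos hq0 (by linarith)) (by omega)
    · exact iff_of_true (mul_pos hq0 h1) (by omega)
    · exact iff_of_false (lt_irrefl _) (by omega)

theorem geom_isNatDistribution (hbase : P.base = geomBase K hK) (hc : P.c = K)
    (hh : P.h = K + 1) (hq : P.q < 1) (b : Bool) : IsNatDistribution (P.law b) := by
  refine ⟨?_, by rw [geom_natSupport hbase hc hh hq]; exact ordConnected_Iic⟩
  have hm : MeasurableSet (range ((↑) : ℕ → ℝ)) := (countable_range _).measurableSet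
  have h := P.law_real b hm
  have h1 : P.c ∈ range ((↑) : ℕ → ℝ) := ⟨K, hc.symm⟩
  have h2 : P.h ∈ range ((↑) : ℕ → ℝ) := ⟨K + 1, by rw [hh]; push_cast; rfl⟩
  rw [indicator_of_mem h1, indicator_of_mem h2, measureReal_def (P.base : Measure ℝ), hbase,
    geomBase_apply_eq_one hK hm fun j _ => ⟨j, rfl⟩] at h
  have h3 : (P.law b : Measure ℝ).real (range ((↑) : ℕ → ℝ)) = 1 := by
    rw [h]; simp only [ENNReal.toReal_one, Pi.one_apply]; ring
  rwa [measureReal_def, ENNReal.toReal_eq_one_iff] at h3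

/-- The virtual value at the critical value is `critVirtual`. -/
theorem geom_virtualValue_critical (hbase : P.base = geomBase K hK) (hc : P.c = K)
    (hh : P.h = K + 1) (b : Bool) :
    virtualValue (P.law b) (mass (P.law b)) K = K - P.top b / (1 - P.top b) := by
  unfold virtualValue
  rw [geom_tail_critical hbase hc hh, geom_mass_of_ge hbase hc hh b le_rfl, if_pos rfl,
    mul_div_mul_left _ _ P.q_pos.ne']

theorem geom_virtualValue_top (hbase : P.base = geomBase K hK) (hc : P.c = K)
    (hh : P.h = K + 1) (b : Bool) :
    virtualValue (P.law b) (mass (P.law b)) ((K + 1 : ℕ) : ℝ) = ((K + 1 : ℕ) : ℝ) := by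
  unfold virtualValue
  push_cast
  rw [geom_tail_top hbase hc hh]; simp

/-- If the tail of the nontrivial values continues the geometric distribution, the hazard rate is
constant below the critical value, so that the law is MHR as soon as `top b ≤ 1/2`. -/
theorem geom_mem_mhrDistributions (hbase : P.base = geomBase K hK) (hc : P.c = K)
    (hh : P.h = K + 1) (hq : P.q = (1 / 2) ^ K) (b : Bool) (htop : P.top b ≤ 1 / 2) :
    P.law b ∈ mhrDistributions := by
  have hK1 := half_pow_lt_one hK
  have hq1 : P.q < 1 := by rw [hq]; exact hK1
  refine Or.inr (Or.inl ⟨geom_isNatDistribution hbase hc hh hq1 b, ?_⟩)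
  rw [geom_natSupport hbase hc hh hq1]
  have hlow : ∀ j < K, virtualValue (P.law b) (mass (P.law b)) (j : ℝ) - j = -1 := by
    intro j hj
    unfold virtualValue
    rw [geom_tail_of_lt hbase hc hh b hj, geom_mass_of_lt hbase hc hh b hj, hq, geomWeight]
    have : (1 : ℝ) - (1 / 2) ^ K ≠ 0 := (sub_pos.2 hK1).ne'
    field_simp
    ring
  have hcrit : -1 ≤ virtualValue (P.law b) (mass (P.law b)) (K : ℝ) - K ∧
      virtualValue (P.law b) (mass (P.law b)) (K : ℝ) - K ≤ 0 := by
    rw [geom_virtualValue_critical hbase hc hh]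
    have h1 := P.top_pos b
    have h2 : P.top b / (1 - P.top b) ≤ 1 := by
      rw [div_le_one (by linarith)]; linarith
    have h3 : 0 ≤ P.top b / (1 - P.top b) := div_nonneg h1.le (by linarith)
    constructor <;> linarith
  have htop' := geom_virtualValue_top hbase hc hh b
  intro i hi j hj hij
  simp only [mem_Iic] at hi hj
  change virtualValue _ _ (i : ℝ) - i ≤ virtualValue _ _ (j : ℝ) - j
  rcases lt_trichotomy i K with h1 | rfl | h1
  · rw [hlow i h1]
    rcases lt_trichotomy j K with h2 | rfl | h2
    · rw [hlow j h2]
    · exact hcrit.1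
    · obtain rfl : j = K + 1 := by omega
      rw [htop']; norm_num
  · rcases hij.eq_or_lt with rfl | h2
    · exact le_rfl
    · obtain rfl : j = i + 1 := by omega
      rw [htop', sub_self]; exact hcrit.2
  · obtain rfl : j = i := by omega
    exact le_rfl

/-- The law on the values `0`, `1` and `2` is regular as soon as the virtual value at `1` is at
least that at `0`. -/
theorem geom_one_mem_regularDistributions {hK : 0 < 1} (hbase : P.base = geomBase 1 hK)
    (hc : P.c = 1) (hh : P.h = 2) (hq : P.q < 1) (b : Bool)
    (hcrit : -P.q ≤ 1 - P.top b / (1 - P.top b)) : P.law b ∈ regularDistributions := by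
  have hc' : P.c = (1 : ℕ) := by rw [hc]; simp
  have hh' : P.h = (1 : ℕ) + 1 := by rw [hh]; norm_num
  refine Or.inr (Or.inl ⟨geom_isNatDistribution hbase hc' hh' hq b, ?_⟩)
  rw [geom_natSupport hbase hc' hh' hq]
  have h0 : virtualValue (P.law b) (mass (P.law b)) ((0 : ℕ) : ℝ) ≤ -P.q := by
    unfold virtualValue
    rw [geom_tail_of_lt hbase hc' hh' b one_pos, geom_mass_of_lt hbase hc' hh' b one_pos,
      geomWeight]
    norm_num
    exact (le_div_iff₀ (by linarith)).2 (by nlinarith [P.q_pos])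
  have h1 := geom_virtualValue_critical hbase hc' hh' b
  have h2 := geom_virtualValue_top hbase hc' hh' b
  have h3 : 0 ≤ P.top b / (1 - P.top b) :=
    div_nonneg (P.top_pos b).le (by linarith [P.top_lt_one b])
  push_cast at h1 h2
  intro i hi j hj hij
  simp only [mem_Iic] at hi hj
  push_cast at h0
  have hq0 := P.q_pos
  interval_cases i <;> interval_cases j
  all_goals push_cast
  · exact le_rfl
  · rw [h1]; linarith
  · rw [h2]; linarith
  · exact le_rfl
  · rw [h1, h2]; linarith
  · exact le_rfl

end GeomHardPair

/-! ### Regular distributions -/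

/-- The hard pair has the values `0`, `1` and `2`, with `q = 256 ε / k` and `δ = 32 ε`. Its virtual
value is about `-q` at `0` and `B ± O(δ)` at `1`. Regularity requires the former to be the smaller
one: for several bidders an offer `B` of order `ε` ensures this, for a single bidder `q` itself is
large enough. The optimal revenue is of order `ε` and so the losses are of order `ε²`. -/
theorem regular_lower_bound_aux {n m : ℕ} {ε B : ℝ} (A : LearningAlgorithm n m)
    (S : Finset (Fin n)) (hcard : 0 < S.card)
    (hB : (B = 0 ∧ S.card = 1) ∨ (B = 256 * ε ∧ S ≠ Finset.univ))
    (hε : 0 < ε) (hε' : ε ≤ 1 / 4096) (hA : A.SucceedsOn regularDistributions (IsMulApprox ε)) :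
    1 / 10 < m * (20 * (256 * ε / S.card * (32 * ε) ^ 2)) := by
  have hk1 : (1 : ℝ) ≤ S.card := by exact_mod_cast hcard
  have hB0 : 0 ≤ B := by rcases hB with ⟨h, -⟩ | ⟨h, -⟩ <;> rw [h]; positivity
  have hB1 : B ≤ 1 / 8 := by rcases hB with ⟨h, -⟩ | ⟨h, -⟩ <;> rw [h] <;> linarith
  have hq1 : 256 * ε / S.card ≤ 1 / 2 := by rw [div_le_iff₀ (by linarith)]; linarith
  have hr1 : 7 / 15 ≤ (1 - B) / (2 - B) := by
    rw [div_le_div_iff₀ (by norm_num) (by linarith)]; linarith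
  have hr2 : (1 - B) / (2 - B) ≤ 1 / 2 - B / 4 := by
    rw [div_le_iff₀ (by linarith)]; nlinarith
  have hr : (2 - B) * ((1 - B) / (2 - B)) = 1 - B := mul_div_cancel₀ _ (by linarith)
  have hr' : ((1 : ℕ) - B) / ((1 : ℕ) + 1 - B) = (1 - B) / (2 - B) := by
    push_cast; rw [one_add_one_eq_two]
  let P := geomHardPair 1 one_pos B (256 * ε / S.card) (32 * ε) hB0 (by simpa using hB0)
    (by push_cast; linarith) (by positivity) (by linarith) (by positivity)
    (by rw [hr']; linarith) (by rw [hr']; linarith)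
  have hratio : P.ratio = (1 - B) / (2 - B) := hr'
  have hPB : P.B = B := rfl
  have hPh : P.h = 2 := by simp only [P, geomHardPair]; norm_num
  have hPc : P.c = 1 := by simp [P, geomHardPair]
  have hPq : P.q = 256 * ε / S.card := rfl
  have hPδ : P.δ = 32 * ε := rfl
  have hkq : S.card * P.q = 256 * ε := by rw [hPq]; field_simp
  have htop : ∀ b, P.top b ≤ (1 - B) / (2 - B) + 32 * ε := fun b => by
    have := P.top_le b
    rwa [hratio, hPδ] at this
  have hF : ∀ b, P.law b ∈ regularDistributions := fun b => by
    refine geom_one_mem_regularDistributions (hK := one_pos) rfl hPc hPh (by linarith) b ?_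
    have ht := htop b
    have h1 : 0 < 1 - P.top b := by linarith
    have : P.top b / (1 - P.top b) ≤ 1 + P.q := by
      rw [div_le_iff₀ h1]
      rcases hB with ⟨hB, hc⟩ | ⟨hB, -⟩
      · have hq : P.q = 256 * ε := by rw [hPq, hc]; simp
        rw [hB] at hr2
        have h2 : P.top b ≤ 1 / 2 + 32 * ε := by rw [hB] at ht; linarith
        rw [hq]
        have h3 : (1 + 256 * ε) * (1 / 2 - 32 * ε) ≤ (1 + 256 * ε) * (1 - P.top b)  :=
          mul_le_mul_of_nonneg_left (by linarith) (by positivity)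
        nlinarith
      · have h2 := P.q_pos
        have h3 : P.top b ≤ 1 / 2 := by linarith
        nlinarith
    linarith
  have h := P.one_tenth_lt_mul_chi_of_mul S A (hB.imp (fun h => h.1) fun h => h.2) hcard hε.le
    (by linarith) hA hF (fun _ => Or.inr (Or.inr (isPointMass_diracProba hB0)))
    (by
      rw [← mul_assoc (S.card : ℝ) P.q, mul_assoc (1 / 8 : ℝ), ← mul_assoc (S.card : ℝ) P.q, hkq,
        hratio, hPB, hPh, hPδ, mul_add (2 - B), hr]
      have h3 : B ≤ 256 * ε := by
        rcases hB with ⟨h, -⟩ | ⟨h, -⟩ <;> rw [h]; positivity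
      have h4 : (2 - B) * (2 * (32 * ε)) ≤ 1 / 8 := by nlinarith
      have h5 : 256 * ε * (1 - B + (2 - B) * (2 * (32 * ε))) ≤ 256 * ε * (9 / 8) := by
        gcongr; linarith
      have h6 : ε * (B + 256 * ε * (1 - B + (2 - B) * (2 * (32 * ε)))) ≤ ε * (576 * ε) := by
        gcongr; linarith
      have h7 : 1 / 8 * (256 * ε * (15 / 8 * (32 * ε)))
          ≤ 1 / 8 * (256 * ε * ((2 - B) * (32 * ε))) := by gcongr; linarith
      nlinarith [mul_pos hε hε])
    (by nlinarith [P.q_pos])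
  have hchi := P.chi_le (by rw [hratio, hPδ]; linarith) (by rw [hratio, hPδ]; linarith)
  exact h.trans_le (mul_le_mul_of_nonneg_left hchi (Nat.cast_nonneg m))

theorem regular_lower_bound {n m : ℕ} {ε : ℝ} (A : LearningAlgorithm n m) (hn : 1 ≤ n)
    (hε : 0 < ε) (hε' : ε ≤ 1 / 4096) (hA : A.SucceedsOn regularDistributions (IsMulApprox ε)) :
    1 / 200000000 * n / ε ^ 3 ≤ m := by
  have key : ∀ k : ℝ, 1 ≤ k → n ≤ 2 * k → 1 / 10 < m * (20 * (256 * ε / k * (32 * ε) ^ 2)) →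
      1 / 200000000 * n / ε ^ 3 ≤ m := by
    intro k hk hnk h
    rw [show m * (20 * (256 * ε / k * (32 * ε) ^ 2)) = m * (5242880 * ε ^ 3) / k by
      field_simp; ring, lt_div_iff₀ (by linarith)] at h
    rw [div_le_iff₀ (by positivity)]
    nlinarith
  rcases hn.eq_or_lt with rfl | hn2
  · refine key 1 le_rfl (by norm_num) ?_
    simpa using regular_lower_bound_aux A Finset.univ (by simp) (Or.inl ⟨rfl, by simp⟩) hε hε' hA
  · obtain ⟨S, hS, hcard⟩ := exists_finset_card_eq_pred hn
    have hk : (S.card : ℝ) = n - 1 := by rw [hcard, Nat.cast_sub hn]; simp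
    have hn' : (2 : ℝ) ≤ n := by exact_mod_cast hn2
    exact key S.card (by linarith) (by linarith)
      (regular_lower_bound_aux A S (by omega) (Or.inr ⟨rfl, hS⟩) hε hε' hA)

/-! ### MHR distributions -/

theorem mhr_lower_bound {n m : ℕ} {ε : ℝ} (A : LearningAlgorithm n m) (hn : 2 ≤ n)
    (hε : 0 < ε) (hε' : ε * Real.log n ≤ 1 / 10000)
    (hA : A.SucceedsOn mhrDistributions (IsMulApprox ε)) :
    1 / 100000000 * n / (ε ^ 2 * Real.log n ^ 2) ≤ m := by
  obtain ⟨S, hS, hcard⟩ := exists_finset_card_eq_pred (n := n) (by omega)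
  have hk : (S.card : ℝ) = n - 1 := by rw [hcard, Nat.cast_sub (by omega)]; simp
  have hn' : (2 : ℝ) ≤ n := by exact_mod_cast hn
  have hlog2 := Real.log_two_gt_d9
  have hlogn : Real.log 2 ≤ Real.log n := Real.log_le_log (by norm_num) hn'
  -- the nontrivial values start at the quantile `q ≈ 1 / n`, that is, at a value `K ≈ log n`
  set K := Nat.clog 2 (2 * n) with hKdef
  have hKpow : 2 * n ≤ 2 ^ K := Nat.le_pow_clog (by norm_num) _
  have hK : 0 < K := Nat.clog_pos (by norm_num) (by omega)
  have hKpow' : 2 ^ K < 4 * n := by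
    have h1 : 2 ^ (K - 1) < 2 * n := Nat.pow_pred_clog_lt_self (by norm_num) (by omega)
    have h2 : 2 ^ K = 2 ^ (K - 1) * 2 := by rw [← pow_succ, Nat.sub_add_cancel hK]
    omega
  have hKr : 2 * (n : ℝ) ≤ 2 ^ K := by exact_mod_cast hKpow
  have hKr' : (2 : ℝ) ^ K < 4 * n := by exact_mod_cast hKpow'
  have hK1 : (1 : ℝ) ≤ K := by exact_mod_cast hK
  have hKlog : K ≤ 5 * Real.log n := by
    have h1 : K * Real.log 2 ≤ Real.log 4 + Real.log n := by
      rw [← Real.log_pow, ← Real.log_mul (by norm_num) (by positivity)]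
      exact Real.log_le_log (by positivity) hKr'.le
    have h2 : Real.log 4 = 2 * Real.log 2 := by
      rw [show (4 : ℝ) = 2 ^ 2 by norm_num, Real.log_pow]; norm_num
    have h3 : (K : ℝ) * (3 / 5) ≤ K * Real.log 2 := by gcongr; linarith
    linarith
  have hεK : ε * K ≤ 5 / 10000 := by nlinarith
  have hε1 : ε ≤ 1 / 2 := by nlinarith
  have hr : ((K : ℝ) - (K - 1 / 2)) / (K + 1 - (K - 1 / 2)) = 1 / 3 := by
    rw [show (K : ℝ) - (K - 1 / 2) = 1 / 2 by ring,
      show (K : ℝ) + 1 - (K - 1 / 2) = 3 / 2 by ring]; norm_num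
  -- the offer `K - 1/2` makes `ratio = 1/3`, so that `top b ≤ 1/2` and the law is MHR
  let P := geomHardPair K hK (K - 1 / 2) ((1 / 2) ^ K) (128 * (ε * K)) (by linarith) (by linarith)
    (by linarith) (by positivity) (half_pow_lt_one hK).le (by positivity)
    (by rw [hr]; linarith) (by rw [hr]; linarith)
  have hratio : P.ratio = 1 / 3 := hr
  have hPB : P.B = K - 1 / 2 := rfl
  have hhB : P.h - P.B = 3 / 2 := by simp only [P, geomHardPair]; ring
  have hPq : P.q = (1 / 2) ^ K := rfl
  have hPδ : P.δ = 128 * (ε * K) := rfl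
  have hq1 : P.q ≤ 1 / (2 * n) := by
    rw [hPq, one_div_pow]; exact one_div_le_one_div_of_le (by positivity) hKr
  have hq2 : 1 / (4 * n) ≤ P.q := by
    rw [hPq, one_div_pow]; exact one_div_le_one_div_of_le (by positivity) hKr'.le
  rw [le_div_iff₀ (by positivity)] at hq1
  rw [div_le_iff₀ (by positivity)] at hq2
  have hq0 := P.q_pos
  have hkq1 : S.card * P.q ≤ 1 / 2 := by rw [hk]; nlinarith
  have hkq2 : 1 / 8 ≤ S.card * P.q := by rw [hk]; nlinarith
  have hF : ∀ b, P.law b ∈ mhrDistributions := fun b => by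
    refine geom_mem_mhrDistributions (hK := hK) rfl rfl rfl rfl b ?_
    have := P.top_le b
    rw [hratio, hPδ] at this
    linarith
  have h := P.one_tenth_lt_mul_chi_of_mul S A (Or.inr hS) (by omega) hε.le
    (by linarith) hA hF
    (fun _ => Or.inr (Or.inr (isPointMass_diracProba (by rw [hPB]; linarith))))
    (by
      rw [← mul_assoc (S.card : ℝ) P.q, mul_assoc (1 / 8 : ℝ), ← mul_assoc (S.card : ℝ) P.q,
        hratio, hhB, hPB, hPδ]
      set x := S.card * P.q
      have h1 : x * (3 / 2 * (1 / 3 + 2 * (128 * (ε * K)))) ≤ 1 / 2 * 1 := by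
        gcongr; linarith
      have h2 : ε * (K - 1 / 2 + x * (3 / 2 * (1 / 3 + 2 * (128 * (ε * K))))) ≤ ε * K := by
        gcongr; linarith
      have h3 : 1 / 8 * (1 / 8 * (3 / 2 * (128 * (ε * K))))
          ≤ 1 / 8 * (x * (3 / 2 * (128 * (ε * K)))) := by gcongr
      have h4 : 0 ≤ ε * K := by positivity
      linarith)
    (by linarith)
  have hchi := P.chi_le (by rw [hratio]; linarith [P.δ_pos]) (by rw [hratio, hPδ]; linarith)
  have h3 : 1 / 10 < m * (20 * (P.q * P.δ ^ 2)) :=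
    h.trans_le (mul_le_mul_of_nonneg_left hchi (Nat.cast_nonneg m))
  have hδ : P.δ ≤ 640 * (ε * Real.log n) := by
    rw [hPδ]
    have := mul_le_mul_of_nonneg_left hKlog hε.le
    linarith
  have hδ2 : P.δ ^ 2 ≤ (640 * (ε * Real.log n)) ^ 2 := pow_le_pow_left₀ P.δ_pos.le hδ 2
  have hlog0 : 0 < Real.log n := by linarith
  rw [div_le_iff₀ (by positivity)]
  have h4 : P.q * n * P.δ ^ 2 ≤ 1 / 2 * (640 * (ε * Real.log n)) ^ 2 := by
    gcongr; linarith
  have h5 : (1 / 10) * n ≤ m * (20 * (P.q * P.δ ^ 2)) * n := by gcongr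
  have h6 : (m : ℝ) * (20 * (P.q * n * P.δ ^ 2))
      ≤ m * (20 * (1 / 2 * (640 * (ε * Real.log n)) ^ 2)) := by gcongr
  nlinarith

/-! ### Lower bounds for the four families -/

theorem mainTheorem2 :
    (∃ c > (0 : ℝ), ∃ ε₀ > (0 : ℝ), ∀ (n m : ℕ) (ε : ℝ) (A : LearningAlgorithm n m),
      1 ≤ n → 0 < ε → ε ≤ ε₀ →
      A.SucceedsOn regularDistributions (IsMulApprox ε) →
      c * n / ε ^ 3 ≤ m) ∧
    (∃ c > (0 : ℝ), ∃ ε₀ > (0 : ℝ), ∀ (n m : ℕ) (ε : ℝ) (A : LearningAlgorithm n m),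
      2 ≤ n → 0 < ε → ε * Real.log n ≤ ε₀ →
      A.SucceedsOn mhrDistributions (IsMulApprox ε) →
      c * n / (ε ^ 2 * Real.log n ^ 2) ≤ m) ∧
    (∃ c > (0 : ℝ), ∃ ε₀ > (0 : ℝ), ∀ (n m : ℕ) (H ε : ℝ) (A : LearningAlgorithm n m),
      1 ≤ n → 2 ≤ H → 0 < ε → ε ≤ ε₀ →
      A.SucceedsOn (boundedDistributions 1 H) (IsMulApprox ε) →
      c * n * H / ε ^ 2 ≤ m) ∧
    (∃ c > (0 : ℝ), ∃ ε₀ > (0 : ℝ), ∀ (n m : ℕ) (ε : ℝ) (A : LearningAlgorithm n m),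
      1 ≤ n → 0 < ε → ε ≤ ε₀ →
      A.SucceedsOn (boundedDistributions 0 1) (IsAddApprox ε) →
      c * n / ε ^ 2 ≤ m) := by
  refine ⟨⟨1 / 200000000, by norm_num, 1 / 4096, by norm_num, ?_⟩,
    ⟨1 / 100000000, by norm_num, 1 / 10000, by norm_num, ?_⟩,
    ⟨1 / 1000000, by norm_num, 1 / 640, by norm_num, ?_⟩,
    ⟨1 / 100000, by norm_num, 1 / 640, by norm_num, ?_⟩⟩
  · exact fun n m ε A hn hε hε' hA => regular_lower_bound A hn hε hε' hA
  · exact fun n m ε A hn hε hε' hA => mhr_lower_bound A hn hε hε' hA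
  · intro n m H ε A hn hH hε hε' hA
    rcases hn.eq_or_lt with rfl | hn2
    · simpa using bounded_lower_bound_one A hH hε hε' hA
    · exact bounded_lower_bound_of_two_le A hn2 hH hε hε' hA
  · exact fun n m ε A hn hε hε' hA => unit_lower_bound A hn hε hε' hA
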